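/- Let $(M,\sigma)$ be a model of ACFA: $M$ is an algebraically closed field, $\sigma$ is an automorphism of $M$, and for every irreducible affine variety $U$ over $M$, every irreducible subvariety $V\subseteq U\times\sigma(U)$ projecting dominantly to both factors, and every proper closed subset $W\subsetneq V$, there is a point $x\in U(M)$ with $(x,\sigma(x))\in V\setminus W$. Let $C(M)=\{x\in M:\sigma(x)=x\}$ be the fixed field. Let $k$ be a difference subfield of $M$, i.e. a subfield with $\sigma(k)\subseteq k$, and put $C(k)=k\cap C(M)$. Then $k$ and $C(M)$ are linearly disjoint over $C(k)$ (inside $M$). Moreover, $$\mathrm{dcl}_\sigma(k)\cap C(M)\ \subseteq\ \mathrm{acl}(C(k))\cap C(M).$$ Here $\mathrm{dcl}_\sigma(k)$ is the definable closure of $k$ in the difference field $(M,\sigma)$, that is, the set of $b\in M$ such that $\{b\}$ is definable with parameters from $k$ by a first-order formula in the language of rings with a unary function symbol for $\sigma$; and $\mathrm{acl}(C(k))$ is the algebraic closure of $C(k)$ in the pure field $M$, that is, the set of $b\in M$ that lie in a finite subset of $M$ definable with parameters from $C(k)$ in the language of rings (without $\sigma$). -/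

import Mathlib

namespace ACFA

universe u v w

/-! ### Definable and algebraic closure in a first-order structure -/

/-- The definable closure of `A` in the `L`-structure `M`: all `b` such that `{b}` is definable
by an `L`-formula with parameters from `A`. -/
def dcl (L : FirstOrder.Language.{u, v}) {M : Type w} [L.Structure M] (A : Set M) : Set M :=
  {b | A.Definable₁ L {b}}

/-- The (model-theoretic) algebraic closure of `A` in the `L`-structure `M`: all `b` lying in some
finite set that is definable by an `L`-formula with parameters from `A`. -/
def acl (L : FirstOrder.Language.{u, v}) {M : Type w} [L.Structure M] (A : Set M) : Set M :=
  {b | ∃ S : Set M, S.Finite ∧ A.Definable₁ L S ∧ b ∈ S}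

/-! ### The language of difference rings -/

/-- The single additional function symbol: a unary symbol `σ`. -/
inductive SigmaFunc : ℕ → Type
  | sigma : SigmaFunc 1

/-- The language with one unary function symbol `σ` and no relation symbols. -/
def sigmaLanguage : FirstOrder.Language.{0, 0} where
  Functions := SigmaFunc
  Relations := fun _ => Empty

/-- The language of difference rings: the language of rings together with the symbol `σ`. -/
abbrev diffRing : FirstOrder.Language.{0, 0} := FirstOrder.Language.ring.sum sigmaLanguage

/-- A map `σ : M → M` as a structure for the language with one unary function symbol. -/
@[reducible]
def sigmaStructure {M : Type w} (σ : M → M) : sigmaLanguage.Structure M where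
  funMap := fun {_} f =>
    match f with
    | SigmaFunc.sigma => fun x => σ (x 0)
  RelMap := fun r => Empty.elim r

/-- The field `M` as a structure for the language of rings. -/
@[reducible]
def ringStructure (M : Type w) [Field M] : FirstOrder.Language.ring.Structure M :=
  (FirstOrder.Ring.compatibleRingOfRing M).toStructure

/-- The difference field `(M, σ)` as a structure for the language of difference rings. -/
@[reducible]
def diffRingStructure {M : Type w} [Field M] (σ : M ≃+* M) : diffRing.Structure M :=
  letI : FirstOrder.Language.ring.Structure M := ringStructure M
  letI : sigmaLanguage.Structure M := sigmaStructure (fun x => σ x)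
  inferInstance

/-- `dcl_σ(A)`: definable closure in the difference field `(M, σ)`. -/
def dclSigma {M : Type w} [Field M] (σ : M ≃+* M) (A : Set M) : Set M :=
  letI : diffRing.Structure M := diffRingStructure σ
  dcl diffRing A

/-- `acl(A)`: algebraic closure in the pure field `M` (language of rings). -/
def aclField {M : Type w} [Field M] (A : Set M) : Set M :=
  letI : FirstOrder.Language.ring.Structure M := ringStructure M
  acl FirstOrder.Language.ring A

/-! ### Models of ACFA -/

/-- `(K, σ)` is a model of ACFA: `K` is an algebraically closed field, `σ` is an automorphism of
`K`, and for all irreducible varieties `U` and `V ⊆ U × σ(U)` over `K` such that `V` projects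
dominantly to `U` and to `σ(U)`, and every proper closed subset `W` of `V`, there is a point
`x ∈ U(K)` with `(x, σ(x)) ∈ V \ W`.

An irreducible closed subvariety of affine space over the algebraically closed field `K` is given
by its (prime) ideal: `P` is the ideal of `U` in `K[X₁, …, Xₙ]`, and `Q` that of `V` in
`K[X₁, …, Xₙ, Y₁, …, Yₙ]`; the ideal of `σ(U)` is `P ^ σ`, obtained by applying `σ` to coefficients.
The Zariski closure of a projection of `V` is the variety of the contraction of `Q`, so `V` is
contained in `U × σ(U)` and dominates both factors exactly when `Q ∩ K[X] = P` and
`Q ∩ K[Y] = P ^ σ`. A closed subset `W` of `V` is proper when some polynomial `g` that vanishes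
on `W` does not belong to `Q`; it is enough to avoid the zero set of `g`. -/
structure IsModel (K : Type w) [Field K] (σ : K ≃+* K) : Prop where
  isAlgClosed : IsAlgClosed K
  exists_point : ∀ (n : ℕ) (P : Ideal (MvPolynomial (Fin n) K))
    (Q : Ideal (MvPolynomial (Fin n ⊕ Fin n) K)) (g : MvPolynomial (Fin n ⊕ Fin n) K),
    P.IsPrime → Q.IsPrime →
    Q.comap (MvPolynomial.rename (R := K) (Sum.inl : Fin n → Fin n ⊕ Fin n)) = P →
    Q.comap (MvPolynomial.rename (R := K) (Sum.inr : Fin n → Fin n ⊕ Fin n)) =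
      P.map (MvPolynomial.map (σ : K →+* K)) →
    g ∉ Q →
    ∃ x : Fin n → K,
      (∀ f ∈ Q, MvPolynomial.eval (Sum.elim x (fun i => σ (x i))) f = 0) ∧
      MvPolynomial.eval (Sum.elim x (fun i => σ (x i))) g ≠ 0

/-! ### Fixed fields -/

/-- The fixed field `C(M) = {x ∈ M | σ(x) = x}`. -/
def fixedField {M : Type w} [Field M] (σ : M ≃+* M) : Subfield M :=
  (σ : M →+* M).eqLocusField (RingHom.id M)

/-- The fixed field `C(k) = k ∩ C(M)` of a subfield `k`. -/
def fixedFieldOf {M : Type w} [Field M] (σ : M ≃+* M) (k : Subfield M) : Subfield M :=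
  k ⊓ fixedField σ

theorem fixedFieldOf_le_left {M : Type w} [Field M] (σ : M ≃+* M) (k : Subfield M) :
    fixedFieldOf σ k ≤ k := inf_le_left

theorem fixedFieldOf_le_right {M : Type w} [Field M] (σ : M ≃+* M) (k : Subfield M) :
    fixedFieldOf σ k ≤ fixedField σ := inf_le_right

end ACFA

/-!
The argument rests on one consequence of the axioms of ACFA: any two embeddings of `M` into a model
that agree on `k` preserve formulas over `k`. To use it one needs a model that contains two copies
of `M`, as independent as possible over `k`.

*Linear disjointness.* A shortest linear relation over `k` between elements of `C(M)`, normalized to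
have a coefficient `1`, becomes shorter on subtracting its image under `σ`; hence its coefficients
lie in `C(k)` (`linearIndependent_of_fixedField`). Applied to the powers of `b ∈ C(M)`, this shows
that `b` is algebraic over `C(k)` if it is algebraic over `k` (`isAlgebraic_fixedFieldOf`). As the
zero set of a polynomial is finite and definable, it remains to show that an element of
`dcl_σ(k) ∩ C(M)` is algebraic over `k`.

*Models are existentially closed.* The axioms say that a quantifier-free type of a tuple over `M`,
realized in some difference field extending `M`, is finitely realized in `M`
(`IsModel.isExistentiallyClosed`). The notion used here mentions only an isomorphism
`M(c) ≃ M(c')` extending `σ`, not an automorphism of a larger field. By a choice of an ultrafilter,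
a difference field whose type over `M` makes sense in this way embeds in an ultrapower of `M`
(`IsExistentiallyClosed.exists_ringHom_germ`).

*Model completeness.* Ultrapowers of existentially closed algebraically closed difference fields are
again existentially closed (`IsExistentiallyClosed.germ`). Here an isomorphism between finitely
generated extensions of the ultrapower has to be brought down to almost all coordinates. Over an
algebraically closed field such an extension is the function field of a hypersurface, and the ideal
of a generic point of a hypersurface is generated by one equation (Gauss's lemma), so a single
polynomial controls the isomorphism type (`eventually_aeval_eq_zero_iff`). That the equation stays
irreducible, and generic points stay generic, uses degree bounds for factors and counting in the
matroid of algebraic dependence. Robinson's test then shows that embeddings between such difference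
fields are elementary (`realize_iff_of_ringHom`).

*Definable closure.* Let `K` be the set of elements that some power of `σ` moves into the algebraic
closure of `k`. It is an algebraically closed field stable under `σ` and its inverse, so
`M ⊗[K] M` is a domain (`isDomain_tensorProduct`) on which `σ ⊗ σ` acts. Its fraction field contains
two copies of `M` that meet exactly in `K`, and it embeds the second copy in an ultrapower of the
first. An element `b` of `dcl_σ(k)` satisfies in `M` a formula over `k` with a unique solution; by
model completeness and Łoś's theorem both copies of `b` solve it in the ultrapower, so they agree
and `b ∈ K` (`dclSigma_subset_invertiveClosure`). If moreover `σ b = b`, then `b` itself is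
algebraic over `k`.
-/

namespace ACFA

universe u

open MvPolynomial Filter

/-! ### Existentially closed difference fields -/

/-- A difference field `(M, σ)` is existentially closed when every finite system of polynomial
equations and one inequation in `(x, σ x)` over `M` that is solved by a pair `(c, c')` from an
extension field is solved in `M`. The extension need not carry a global extension of `σ`: it is
enough that `c` and `c'` satisfy the same polynomials up to `σ`, that is, `c ↦ c'` extends `σ` to
an isomorphism `M(c) ≃ M(c')`. -/
def IsExistentiallyClosed {M : Type u} [Field M] (σ : M ≃+* M) : Prop :=
  ∀ (Ω : Type u) [Field Ω] [Algebra M Ω] (n : ℕ) (c c' : Fin n → Ω),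
    (∀ f : MvPolynomial (Fin n) M, aeval c f = 0 ↔ aeval c' (map (σ : M →+* M) f) = 0) →
    ∀ (Φ : Finset (MvPolynomial (Fin n ⊕ Fin n) M)) (g : MvPolynomial (Fin n ⊕ Fin n) M),
    (∀ f ∈ Φ, aeval (Sum.elim c c') f = 0) → aeval (Sum.elim c c') g ≠ 0 →
    ∃ x : Fin n → M, (∀ f ∈ Φ, eval (Sum.elim x (fun i => σ (x i))) f = 0) ∧
      eval (Sum.elim x (fun i => σ (x i))) g ≠ 0

/-- Apply the axiom to the loci of `c` and of `(c, c')`, that is, to their vanishing ideals. -/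
theorem IsModel.isExistentiallyClosed {M : Type u} [Field M] {σ : M ≃+* M} (hM : IsModel M σ) :
    IsExistentiallyClosed σ := by
  intro Ω _ _ n c c' hcc Φ g hΦ hg
  have hprime : ∀ {ι : Type} (x : ι → Ω), (RingHom.ker (aeval (R := M) x)).IsPrime :=
    fun x => RingHom.ker_isPrime _
  obtain ⟨x, hx, hgx⟩ := hM.exists_point n (RingHom.ker (aeval (R := M) c))
    (RingHom.ker (aeval (R := M) (Sum.elim c c'))) g (hprime _) (hprime _)
    (by
      ext f
      simp [Ideal.mem_comap, RingHom.mem_ker, aeval_rename])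
    (by
      ext f
      have hs : Function.Surjective (map (σ : M →+* M) : MvPolynomial (Fin n) M →+* _) :=
        map_surjective _ σ.surjective
      rw [Ideal.mem_map_iff_of_surjective _ hs]
      simp only [Ideal.mem_comap, RingHom.mem_ker, aeval_rename, Sum.elim_comp_inr]
      constructor
      · intro hf
        obtain ⟨f, rfl⟩ := hs f
        exact ⟨f, (hcc f).2 hf, rfl⟩
      · rintro ⟨f', hf', rfl⟩
        exact (hcc f').1 hf')
    (by simpa [RingHom.mem_ker] using hg)
  exact ⟨x, fun f hf => hx f (by simpa [RingHom.mem_ker] using hΦ f hf), hgx⟩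

/-- In an existentially closed difference field the type of a tuple indexed by any set is finitely
realised, equations and inequations at once. -/
theorem IsExistentiallyClosed.exists_eval_eq_zero_iff {M : Type u} [Field M] {σ : M ≃+* M}
    (hM : IsExistentiallyClosed σ) {Ω : Type u} [Field Ω] [Algebra M Ω] {ι : Type*}
    (c c' : ι → Ω)
    (hcc : ∀ f : MvPolynomial ι M, aeval c f = 0 ↔ aeval c' (map (σ : M →+* M) f) = 0)
    (S : Finset (MvPolynomial (ι ⊕ ι) M)) :
    ∃ x : ι → M, ∀ p ∈ S,
      (eval (Sum.elim x (fun i => σ (x i))) p = 0 ↔ aeval (Sum.elim c c') p = 0) := by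
  classical
  let V : Finset (ι ⊕ ι) := S.biUnion vars
  let W : Finset ι := V.image (Sum.elim id id)
  let e : Fin W.card ≃ W := W.equivFin.symm
  let r : Fin W.card → ι := fun i => (e i : ι)
  have hr : Function.Injective r := Subtype.val_injective.comp e.injective
  have hlift : ∀ p ∈ S, ∃ q : MvPolynomial (Fin W.card ⊕ Fin W.card) M,
      rename (Sum.map r r) q = p := by
    intro p hp
    refine exists_rename_eq_of_vars_subset_range p (Sum.map r r) (Sum.map_injective.2 ⟨hr, hr⟩) ?_
    intro v hv
    have hvW : Sum.elim id id v ∈ W :=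
      Finset.mem_image_of_mem _ (Finset.mem_biUnion.2 ⟨p, hp, hv⟩)
    rcases v with v | v
    · exact ⟨Sum.inl (e.symm ⟨v, hvW⟩), by simp [r]⟩
    · exact ⟨Sum.inr (e.symm ⟨v, hvW⟩), by simp [r]⟩
  choose! L hL using hlift
  have hev : ∀ p ∈ S, aeval (Sum.elim (c ∘ r) (c' ∘ r)) (L p) = aeval (Sum.elim c c') p := by
    intro p hp
    conv_rhs => rw [← hL p hp, aeval_rename]
    rw [Sum.elim_comp_map]
  obtain ⟨x, hx, hgx⟩ := hM Ω _ (c ∘ r) (c' ∘ r)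
    (fun f => by
      have := hcc (rename r f)
      rwa [map_rename, aeval_rename, aeval_rename] at this)
    ((S.filter fun p => aeval (Sum.elim c c') p = 0).image L)
    (∏ p ∈ S.filter fun p => aeval (Sum.elim c c') p ≠ 0, L p)
    (by
      intro f hf
      obtain ⟨p, hp, rfl⟩ := Finset.mem_image.1 hf
      rw [Finset.mem_filter] at hp
      rw [hev p hp.1, hp.2])
    (by
      rw [map_prod, Finset.prod_ne_zero_iff]
      intro p hp
      rw [Finset.mem_filter] at hp
      rw [hev p hp.1]
      exact hp.2)
  refine ⟨Function.extend r x 0, fun p hp => ?_⟩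
  have hxp : eval (Sum.elim (Function.extend r x 0) (fun i => σ (Function.extend r x 0 i))) p =
      eval (Sum.elim x (fun i => σ (x i))) (L p) := by
    conv_lhs => rw [← hL p hp, eval_rename]
    congr 1
    congr 1
    ext (i | i) <;> simp [hr.extend_apply]
  rw [hxp]
  by_cases h0 : aeval (Sum.elim c c') p = 0
  · exact iff_of_true (hx _ (Finset.mem_image_of_mem _ (Finset.mem_filter.2 ⟨hp, h0⟩))) h0
  · refine iff_of_false ?_ h0
    rw [map_prod, Finset.prod_ne_zero_iff] at hgx
    exact hgx p (Finset.mem_filter.2 ⟨hp, h0⟩)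

/-! ### Ultrapowers of fields -/

section Germ

variable {I R S T : Type*} [Ring R] [Ring S] [Ring T]

/-- The coordinatewise action of a ring homomorphism on germs. -/
def germMap (U : Ultrafilter I) (f : R →+* S) :
    Germ (U : Filter I) R →+* Germ (U : Filter I) S where
  toFun := Germ.map f
  map_one' := congrArg (fun a : I → S => (a : Germ (U : Filter I) S)) (funext fun _ => f.map_one)
  map_zero' := congrArg (fun a : I → S => (a : Germ (U : Filter I) S)) (funext fun _ => f.map_zero)
  map_mul' a b := Germ.inductionOn₂ a b fun a b =>
    congrArg (fun a : I → S => (a : Germ (U : Filter I) S)) (funext fun i => f.map_mul (a i) (b i))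
  map_add' a b := Germ.inductionOn₂ a b fun a b =>
    congrArg (fun a : I → S => (a : Germ (U : Filter I) S)) (funext fun i => f.map_add (a i) (b i))

@[simp]
theorem germMap_coe (U : Ultrafilter I) (f : R →+* S) (a : I → R) :
    germMap U f (a : Germ (U : Filter I) R) =
      ((fun i => f (a i) : I → S) : Germ (U : Filter I) S) := rfl

/-- The automorphism of an ultrapower that acts as `σ` on every coordinate. -/
def germEquiv (U : Ultrafilter I) (σ : R ≃+* R) : Germ (U : Filter I) R ≃+* Germ (U : Filter I) R :=
  RingEquiv.ofRingHom (germMap U (σ : R →+* R)) (germMap U (σ.symm : R →+* R))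
    (by
      ext a
      induction a using Germ.inductionOn with | _ a =>
      simp)
    (by
      ext a
      induction a using Germ.inductionOn with | _ a =>
      simp)

@[simp]
theorem germEquiv_coe (U : Ultrafilter I) (σ : R ≃+* R) (a : I → R) :
    germEquiv U σ (a : Germ (U : Filter I) R) =
      ((fun i => σ (a i) : I → R) : Germ (U : Filter I) R) := rfl

/-- The diagonal embedding of a ring in its ultrapower. -/
def diagonal (U : Ultrafilter I) (R : Type*) [Ring R] : R →+* Germ (U : Filter I) R :=
  (Germ.coeRingHom (U : Filter I)).comp (Pi.constRingHom I R)

end Germ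

/-- A difference field `(N, τ)` that embeds in a field extension of an existentially closed
difference field `(M, σ)`, in such a way that the type of `N` over `M` is `σ`-invariant, embeds in
an ultrapower of `(M, σ)`. The index set is the set of finite fragments of the type. -/
theorem IsExistentiallyClosed.exists_ringHom_germ {M : Type u} [Field M] {σ : M ≃+* M}
    (hM : IsExistentiallyClosed σ) {F : Type u} [Field F] [Algebra M F] {N : Type u} [Field N]
    (τ : N ≃+* N) (j : N →+* F)
    (hj : ∀ f : MvPolynomial N M,
      aeval (fun a => j a) f = 0 ↔ aeval (fun a => j (τ a)) (map (σ : M →+* M) f) = 0) :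
    ∃ (I : Type u) (U : Ultrafilter I) (h : N →+* Germ (U : Filter I) M),
      (∀ a, h (τ a) = germEquiv U σ (h a)) ∧
      ∀ a m, h a = diagonal U M m ↔ j a = algebraMap M F m := by
  classical
  choose x hx using hM.exists_eval_eq_zero_iff (fun a => j a) (fun a => j (τ a)) hj
  let U : Ultrafilter (Finset (MvPolynomial (N ⊕ N) M)) := Ultrafilter.of atTop
  have hU : ∀ p : MvPolynomial (N ⊕ N) M, ∀ᶠ S in (U : Filter _),
      (eval (Sum.elim (x S) (fun i => σ (x S i))) p = 0 ↔
        aeval (Sum.elim (fun a => j a) (fun a => j (τ a))) p = 0) := by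
    intro p
    filter_upwards [Ultrafilter.of_le atTop (mem_atTop {p})] with S hS
    exact hx S p (Finset.singleton_subset_iff.1 hS)
  refine ⟨_, U,
    { toFun := fun a => Germ.ofFun (l := (U : Filter _)) fun S => x S a
      map_one' := ?_
      map_zero' := ?_
      map_mul' := ?_
      map_add' := ?_ }, ?_, ?_⟩
  · refine Germ.coe_eq.2 ?_
    filter_upwards [hU (X (Sum.inl 1) - 1)] with S hS
    simpa [sub_eq_zero] using hS
  · intro a b
    refine Germ.coe_eq.2 ?_
    filter_upwards [hU (X (Sum.inl (a * b)) - X (Sum.inl a) * X (Sum.inl b))] with S hS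
    simpa [sub_eq_zero] using hS
  · refine Germ.coe_eq.2 ?_
    filter_upwards [hU (X (Sum.inl 0))] with S hS
    simpa using hS
  · intro a b
    refine Germ.coe_eq.2 ?_
    filter_upwards [hU (X (Sum.inl (a + b)) - (X (Sum.inl a) + X (Sum.inl b)))] with S hS
    simpa [sub_eq_zero] using hS
  · intro a
    refine Germ.coe_eq.2 ?_
    filter_upwards [hU (X (Sum.inl (τ a)) - X (Sum.inr a))] with S hS
    simpa [sub_eq_zero] using hS
  · intro a m
    have key := hU (X (Sum.inl a) - C m)
    simp only [map_sub, eval_X, eval_C, aeval_X, aeval_C, Sum.elim_inl, sub_eq_zero] at key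
    constructor
    · intro h
      obtain ⟨S, h1, h2⟩ := (key.and (Germ.coe_eq.1 h)).exists
      exact h1.1 h2
    · intro h
      refine Germ.coe_eq.2 ?_
      filter_upwards [key] with S hS
      exact hS.2 h

/-! ### Polynomials over an ultrapower -/

section Polynomial

variable {I : Type*} (U : Ultrafilter I) {R Ω ι : Type*} [Field R] [Field Ω] [Algebra R Ω]

/-- The polynomial over the ultrapower represented by a polynomial over `I → R`. -/
noncomputable abbrev polyGerm (ι : Type*) (R : Type*) [Field R] :
    MvPolynomial ι (I → R) →+* MvPolynomial ι (Germ (U : Filter I) R) :=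
  map (Germ.coeRingHom (U : Filter I))

/-- The `i`-th coordinate of a polynomial over `I → R`. -/
noncomputable abbrev polyAt (i : I) (ι : Type*) (R : Type*) [Field R] :
    MvPolynomial ι (I → R) →+* MvPolynomial ι R :=
  map (Pi.evalRingHom (fun _ => R) i)

/-- The ultrapower of a field extension is an extension of the ultrapower. -/
noncomputable instance germAlgebra : Algebra (Germ (U : Filter I) R) (Germ (U : Filter I) Ω) where
  toSMul := Germ.instSMul'
  algebraMap := germMap U (algebraMap R Ω)
  commutes' _ _ := mul_comm _ _
  smul_def' a b := Germ.inductionOn₂ a b fun a b =>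
    congrArg (fun a : I → Ω => (a : Germ (U : Filter I) Ω))
      (funext fun i => Algebra.smul_def (a i) (b i))

theorem polyGerm_surjective : Function.Surjective (polyGerm U ι R) :=
  map_surjective _ fun a => a.inductionOn fun a => ⟨a, rfl⟩

/-- Polynomials have finite support, so a polynomial over the ultrapower vanishes exactly when
almost all its coordinates do. -/
theorem polyGerm_eq_zero_iff (F : MvPolynomial ι (I → R)) :
    polyGerm U ι R F = 0 ↔ ∀ᶠ i in (U : Filter I), polyAt i ι R F = 0 := by
  have hcoeff : ∀ m, coeff m (polyGerm U ι R F) = 0 ↔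
      ∀ᶠ i in (U : Filter I), coeff m F i = 0 := by
    intro m
    rw [coeff_map]
    exact Germ.coe_eq
  constructor
  · intro h
    have : ∀ᶠ i in (U : Filter I), ∀ m ∈ F.support, coeff m F i = 0 :=
      (eventually_all_finset _).2 fun m _ => (hcoeff m).1 (by rw [h, coeff_zero])
    filter_upwards [this] with i hi
    ext m
    rw [coeff_map, coeff_zero]
    by_cases hm : m ∈ F.support
    · exact hi m hm
    · rw [notMem_support_iff.1 hm, map_zero]
  · intro h
    ext m
    rw [coeff_zero, hcoeff]
    filter_upwards [h] with i hi
    have := congrArg (coeff m) hi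
    rwa [coeff_map, coeff_zero] at this

theorem polyGerm_eq_iff (F G : MvPolynomial ι (I → R)) :
    polyGerm U ι R F = polyGerm U ι R G ↔
      ∀ᶠ i in (U : Filter I), polyAt i ι R F = polyAt i ι R G := by
  rw [← sub_eq_zero, ← map_sub, polyGerm_eq_zero_iff]
  simp [sub_eq_zero]

/-- Evaluation of polynomials over an ultrapower is coordinatewise. -/
theorem aeval_polyGerm (x : ι → I → Ω) (F : MvPolynomial ι (I → R)) :
    aeval (fun k => (x k : Germ (U : Filter I) Ω)) (polyGerm U ι R F) =
      ((fun i => aeval (fun k => x k i) (polyAt i ι R F) : I → Ω) : Germ (U : Filter I) Ω) := by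
  let G : MvPolynomial ι (I → R) →+* (I → Ω) :=
    RingHom.pi fun i => ((aeval fun k => x k i : MvPolynomial ι R →ₐ[R] Ω) : _ →+* Ω).comp
      (polyAt i ι R)
  have : ((aeval fun k => (x k : Germ (U : Filter I) Ω) :
      MvPolynomial ι (Germ (U : Filter I) R) →ₐ[Germ (U : Filter I) R] _) : _ →+* _).comp
      (polyGerm U ι R) = (Germ.coeRingHom (U : Filter I)).comp G := by
    apply MvPolynomial.ringHom_ext
    · intro a
      simp only [RingHom.comp_apply, map_C, RingHom.coe_coe, aeval_C]
      change ((fun i => algebraMap R Ω (a i) : I → Ω) : Germ (U : Filter I) Ω) = (G (C a) : I → Ω)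
      congr 1
      funext i
      simp [G, RingHom.pi_apply]
    · intro k
      simp only [RingHom.comp_apply, map_X, RingHom.coe_coe, aeval_X]
      change ((x k : I → Ω) : Germ (U : Filter I) Ω) = (G (X k) : I → Ω)
      congr 1
      funext i
      simp [G, RingHom.pi_apply]
  exact DFunLike.congr_fun this F

theorem aeval_polyGerm_eq_zero_iff (x : ι → I → Ω) (F : MvPolynomial ι (I → R)) :
    aeval (fun k => (x k : Germ (U : Filter I) Ω)) (polyGerm U ι R F) = 0 ↔
      ∀ᶠ i in (U : Filter I), aeval (fun k => x k i) (polyAt i ι R F) = 0 := by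
  rw [aeval_polyGerm]
  exact Germ.coe_eq

theorem map_germEquiv_polyGerm (σ : R ≃+* R) (F : MvPolynomial ι (I → R)) :
    ∃ F' : MvPolynomial ι (I → R),
      map (germEquiv U σ : Germ (U : Filter I) R →+* _) (polyGerm U ι R F) = polyGerm U ι R F' ∧
        ∀ i, polyAt i ι R F' = map (σ : R →+* R) (polyAt i ι R F) := by
  refine ⟨map (RingHom.pi fun i => (σ : R →+* R).comp (Pi.evalRingHom (fun _ => R) i)) F, ?_, ?_⟩
  · rw [MvPolynomial.map_map, MvPolynomial.map_map]
    rfl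
  · intro i
    rw [MvPolynomial.map_map, MvPolynomial.map_map]
    rfl

/-- A family of polynomials of bounded degree in finitely many variables represents a polynomial
over the ultrapower. -/
theorem exists_polyAt_eq [Finite ι] (D : ℕ) (a : I → MvPolynomial ι R)
    (ha : ∀ i, (a i).totalDegree ≤ D) :
    ∃ A : MvPolynomial ι (I → R), ∀ i, polyAt i ι R A = a i := by
  classical
  have hfin := Finsupp.finite_of_degree_le (σ := ι) D
  refine ⟨∑ m ∈ hfin.toFinset, monomial m fun i => coeff m (a i), fun i => ?_⟩
  rw [map_sum]
  simp only [map_monomial, Pi.evalRingHom_apply]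
  conv_rhs => rw [(a i).as_sum]
  symm
  apply Finset.sum_subset
  · intro m hm
    rw [Set.Finite.mem_toFinset]
    exact (le_totalDegree hm).trans (ha i)
  · intro m _ hm
    rw [notMem_support_iff.1 hm, map_zero]

theorem eventually_not_isUnit_of_not_isUnit [Finite ι] {A : MvPolynomial ι (I → R)}
    (hA : ¬ IsUnit (polyGerm U ι R A)) : ∀ᶠ i in (U : Filter I), ¬ IsUnit (polyAt i ι R A) := by
  classical
  by_contra hcon
  rw [← Ultrafilter.eventually_not] at hcon
  simp only [not_not] at hcon
  apply hA
  -- the inverses are constant polynomials, hence of bounded degree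
  have hinv : ∀ i, ∃ b : MvPolynomial ι R, b.totalDegree ≤ 0 ∧
      (IsUnit (polyAt i ι R A) → polyAt i ι R A * b = 1) := by
    intro i
    by_cases h : IsUnit (polyAt i ι R A)
    · obtain ⟨b, hb⟩ := h.exists_right_inv
      refine ⟨b, ?_, fun _ => hb⟩
      exact (isUnit_iff_totalDegree_of_isReduced.1 (IsUnit.of_mul_eq_one_right _ hb)).2.le
    · exact ⟨0, by simp, fun h' => absurd h' h⟩
  choose b hb0 hb using hinv
  obtain ⟨B, hB⟩ := exists_polyAt_eq 0 b hb0
  refine IsUnit.of_mul_eq_one (polyGerm U ι R B) ?_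
  rw [← map_mul, ← map_one (polyGerm U ι R), polyGerm_eq_iff]
  filter_upwards [hcon] with i hi
  rw [map_mul, hB, hb i hi, map_one]

theorem eventually_isUnit_of_isUnit {A : MvPolynomial ι (I → R)}
    (hA : IsUnit (polyGerm U ι R A)) : ∀ᶠ i in (U : Filter I), IsUnit (polyAt i ι R A) := by
  obtain ⟨b, hb⟩ := hA.exists_right_inv
  obtain ⟨B, rfl⟩ := polyGerm_surjective U b
  rw [← map_mul, ← map_one (polyGerm U ι R), polyGerm_eq_iff] at hb
  filter_upwards [hb] with i hi
  rw [map_mul, map_one] at hi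
  exact IsUnit.of_mul_eq_one _ hi

/-- Factors of a polynomial have bounded degree, so irreducibility over the ultrapower passes to
almost all coordinates. -/
theorem eventually_irreducible [Finite ι] {F : MvPolynomial ι (I → R)}
    (hF : Irreducible (polyGerm U ι R F)) :
    ∀ᶠ i in (U : Filter I), Irreducible (polyAt i ι R F) := by
  by_contra hcon
  rw [← Ultrafilter.eventually_not] at hcon
  have hne : ∀ᶠ i in (U : Filter I), polyAt i ι R F ≠ 0 :=
    Ultrafilter.eventually_not.2 (mt (polyGerm_eq_zero_iff U F).2 hF.ne_zero)
  have hdeg : ∀ i, (polyAt i ι R F).totalDegree ≤ F.totalDegree := fun i =>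
    Finset.sup_mono (support_map_subset _ _)
  have hfac : ∀ i, ∃ a b : MvPolynomial ι R, a.totalDegree ≤ F.totalDegree ∧
      b.totalDegree ≤ F.totalDegree ∧ (polyAt i ι R F ≠ 0 → ¬ IsUnit (polyAt i ι R F) →
        ¬ Irreducible (polyAt i ι R F) → polyAt i ι R F = a * b ∧ ¬ IsUnit a ∧ ¬ IsUnit b) := by
    intro i
    by_cases h : polyAt i ι R F ≠ 0 ∧ ¬ IsUnit (polyAt i ι R F) ∧ ¬ Irreducible (polyAt i ι R F)
    · obtain ⟨h0, h1, h2⟩ := h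
      rw [irreducible_iff] at h2
      push Not at h2
      obtain ⟨a, b, hab, ha, hb⟩ := h2 h1
      have hd := hdeg i
      have hab0 := mul_ne_zero_iff.1 (hab ▸ h0)
      rw [hab, totalDegree_mul_of_isDomain hab0.1 hab0.2] at hd
      exact ⟨a, b, by omega, by omega, fun _ _ _ => ⟨hab, ha, hb⟩⟩
    · exact ⟨0, 0, by simp, by simp, fun h0 h1 h2 => absurd ⟨h0, h1, h2⟩ h⟩
  choose a b ha hb hab using hfac
  obtain ⟨A, hA⟩ := exists_polyAt_eq _ a ha
  obtain ⟨B, hB⟩ := exists_polyAt_eq _ b hb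
  have hall := (hne.and (eventually_not_isUnit_of_not_isUnit U hF.not_isUnit)).and hcon
  have hFAB : polyGerm U ι R F = polyGerm U ι R A * polyGerm U ι R B := by
    rw [← map_mul, polyGerm_eq_iff]
    filter_upwards [hall] with i hi
    rw [map_mul, hA, hB]
    exact (hab i hi.1.1 hi.1.2 hi.2).1
  rcases hF.isUnit_or_isUnit hFAB with h | h
  · obtain ⟨i, hi, hu⟩ := (hall.and (eventually_isUnit_of_isUnit U h)).exists
    exact (hab i hi.1.1 hi.1.2 hi.2).2.1 (hA i ▸ hu)
  · obtain ⟨i, hi, hu⟩ := (hall.and (eventually_isUnit_of_isUnit U h)).exists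
    exact (hab i hi.1.1 hi.1.2 hi.2).2.2 (hB i ▸ hu)

end Polynomial

/-! ### Algebraic relations over an ultrapower -/

section

variable {I : Type*} (U : Ultrafilter I) {R Ω ι : Type*} [Field R] [Field Ω] [Algebra R Ω]

/-- Roots can be chosen coordinatewise. -/
instance germ_isAlgClosed [IsAlgClosed R] : IsAlgClosed (Germ (U : Filter I) R) := by
  refine IsAlgClosed.of_exists_root _ fun p hp hirr => ?_
  have hsurj : Function.Surjective (Germ.coeRingHom (R := R) (U : Filter I)) :=
    fun a => a.inductionOn fun a => ⟨a, rfl⟩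
  have hI : Nonempty I := (U : Filter I).nonempty_of_neBot
  obtain ⟨P, hP, hdeg, hmon⟩ := Polynomial.lifts_and_degree_eq_and_monic
    (f := Germ.coeRingHom (R := R) (U : Filter I))
    ((Polynomial.mem_lifts p).2 (Polynomial.map_surjective _ hsurj p)) hp
  have hroot : ∀ i, ∃ x : R, (P.map (Pi.evalRingHom (fun _ => R) i)).eval x = 0 := by
    intro i
    refine IsAlgClosed.exists_root _ ?_
    rw [hmon.degree_map, hdeg]
    exact (Polynomial.degree_pos_of_irreducible hirr).ne'
  choose x hx using hroot
  refine ⟨Germ.coeRingHom (U : Filter I) x, ?_⟩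
  rw [← hP, Polynomial.eval_map, Polynomial.eval₂_hom]
  have : P.eval x = 0 := by
    funext i
    have h := hx i
    rw [Polynomial.eval_map, show x i = Pi.evalRingHom (fun _ => R) i x from rfl,
      Polynomial.eval₂_hom] at h
    exact h
  rw [this, map_zero]

theorem exists_aeval_adjoin {β A B : Type*} [CommRing A] [CommRing B] [Algebra A B] (b : β → B) :
    ∃ θ : MvPolynomial β A →+* Algebra.adjoin A (Set.range b),
      Function.Surjective θ ∧ ∀ F, (θ F : B) = aeval b F := by
  refine ⟨((aeval (R := A) b).codRestrict (Algebra.adjoin A (Set.range b))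
    (fun F => (Algebra.adjoin_range_eq_range_aeval A b).symm ▸ ⟨F, rfl⟩) : _ →+* _),
    ?_, fun F => rfl⟩
  rintro ⟨w, hw⟩
  obtain ⟨F, hF⟩ := (Algebra.adjoin_range_eq_range_aeval A b) ▸ hw
  exact ⟨F, Subtype.ext hF⟩

/-- An algebraic relation over an ultrapower holds in almost all coordinates. -/
theorem eventually_isAlgebraic_adjoin {β : Type*} (b : β → I → Ω) (z : I → Ω)
    (h : IsAlgebraic (Algebra.adjoin (Germ (U : Filter I) R)
      (Set.range fun k => (b k : Germ (U : Filter I) Ω))) (z : Germ (U : Filter I) Ω)) :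
    ∀ᶠ i in (U : Filter I),
      IsAlgebraic (Algebra.adjoin R (Set.range fun k => b k i)) (z i) := by
  obtain ⟨p, hp0, hp⟩ := h
  obtain ⟨θ₀, hθ₀, hθ₀v⟩ := exists_aeval_adjoin (A := Germ (U : Filter I) R)
    (fun k => (b k : Germ (U : Filter I) Ω))
  have hθi := fun i => exists_aeval_adjoin (A := R) (fun k => b k i)
  choose θi _ hθiv using hθi
  obtain ⟨P, rfl⟩ := Polynomial.map_surjective (θ₀.comp (polyGerm U β R))
    (hθ₀.comp (polyGerm_surjective U)) p
  obtain ⟨k, hk⟩ : ∃ k, (P.map (θ₀.comp (polyGerm U β R))).coeff k ≠ 0 := by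
    by_contra! hcon
    exact hp0 (Polynomial.ext hcon)
  have hk' : ∀ᶠ i in (U : Filter I), aeval (fun j => b j i) (polyAt i β R (P.coeff k)) ≠ 0 := by
    rw [Ultrafilter.eventually_not, ← aeval_polyGerm_eq_zero_iff, ← hθ₀v]
    intro h0
    apply hk
    rw [Polynomial.coeff_map]
    exact Subtype.ext h0
  -- evaluation at `b` and `z` in all coordinates at once
  let G : MvPolynomial β (I → R) →+* (I → Ω) :=
    RingHom.pi fun i => ((aeval fun k => b k i : MvPolynomial β R →ₐ[R] Ω) : _ →+* Ω).comp
      (polyAt i β R)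
  have hev : Germ.coeRingHom (U : Filter I) (P.eval₂ G z) = 0 := by
    rw [← hp, Polynomial.aeval_def, Polynomial.eval₂_map, Polynomial.hom_eval₂]
    congr 1
    refine RingHom.ext fun F => ?_
    exact ((hθ₀v (polyGerm U β R F)).trans (aeval_polyGerm U b F)).symm
  filter_upwards [hk', Germ.coe_eq.1 hev] with i hi hz
  refine ⟨P.map ((θi i).comp (polyAt i β R)), fun h0 => hi ?_, ?_⟩
  · have := congrArg (fun q => Polynomial.coeff q k) h0
    simp only [Polynomial.coeff_map, Polynomial.coeff_zero] at this
    rw [← hθiv]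
    exact congrArg Subtype.val this
  · rw [Polynomial.aeval_def, Polynomial.eval₂_map]
    have hz' : Pi.evalRingHom (fun _ => Ω) i (P.eval₂ G z) = 0 := hz
    rw [Polynomial.hom_eval₂] at hz'
    rw [← hz']
    congr 1
    exact RingHom.ext fun F => hθiv i _

end

/-- Gauss's lemma: an irreducible polynomial that vanishes at `s` divides every polynomial that
does. -/
theorem dvd_of_eval₂_eq_zero {A Ω : Type*} [CommRing A] [IsDomain A] [UniqueFactorizationMonoid A]
    [Field Ω] (g : A →+* Ω) (hg : Function.Injective g) {s : Ω} {q f : Polynomial A}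
    (hq : Irreducible q) (hqs : q.eval₂ g s = 0) (hfs : f.eval₂ g s = 0) : q ∣ f := by
  classical
  let _ : NormalizedGCDMonoid A := Classical.choice inferInstance
  have hqdeg : q.natDegree ≠ 0 := by
    intro h0
    rw [Polynomial.eq_C_of_natDegree_eq_zero h0, Polynomial.eval₂_C] at hqs
    apply hq.ne_zero
    rw [Polynomial.eq_C_of_natDegree_eq_zero h0, (map_eq_zero_iff g hg).1 hqs, map_zero]
  have hqprim : q.IsPrimitive := hq.isPrimitive hqdeg
  have hirr : Irreducible (q.map (algebraMap A (FractionRing A))) :=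
    (Polynomial.IsPrimitive.irreducible_iff_irreducible_map_fraction_map hqprim).1 hq
  let g' : FractionRing A →+* Ω := IsFractionRing.lift hg
  have hg' : g'.comp (algebraMap A (FractionRing A)) = g :=
    RingHom.ext fun x => IsFractionRing.lift_algebraMap hg x
  refine hqprim.dvd_of_fraction_map_dvd_fraction_map (K := FractionRing A) ?_
  by_contra hndvd
  obtain ⟨a, b, hab⟩ := (hirr.coprime_iff_not_dvd).2 hndvd
  have := congrArg (Polynomial.eval₂ g' s) hab
  rw [Polynomial.eval₂_add, Polynomial.eval₂_mul, Polynomial.eval₂_mul, Polynomial.eval₂_map,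
    Polynomial.eval₂_map, hg', hqs, hfs, mul_zero, mul_zero, add_zero, Polynomial.eval₂_one] at this
  exact zero_ne_one this

/-- The ideal of a generic point of an irreducible hypersurface is generated by the equation of
the hypersurface. -/
theorem aeval_eq_zero_iff_dvd {R Ω ι : Type*} [Field R] [Field Ω] [Algebra R Ω]
    {x : Option ι → Ω} (hx : AlgebraicIndependent R fun k => x (some k))
    {q : MvPolynomial (Option ι) R} (hq : Irreducible q) (hqx : aeval x q = 0)
    (f : MvPolynomial (Option ι) R) : aeval x f = 0 ↔ q ∣ f := by
  constructor
  · intro hf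
    have hev : ∀ p : MvPolynomial (Option ι) R, aeval x p =
        (optionEquivLeft R ι p).eval₂ (aeval fun k => x (some k) : _ →ₐ[R] Ω) (x none) := by
      intro p
      induction p using MvPolynomial.induction_on with
      | C a => simp
      | add p q hp hq => rw [map_add, hp, hq, map_add, Polynomial.eval₂_add]
      | mul_X p k hp =>
        rw [map_mul, hp, map_mul, Polynomial.eval₂_mul, aeval_X]
        cases k <;> simp
    rw [← map_dvd_iff (optionEquivLeft R ι)]
    refine dvd_of_eval₂_eq_zero
      ((aeval fun k => x (some k) : MvPolynomial ι R →ₐ[R] Ω) : MvPolynomial ι R →+* Ω) hx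
      ((MulEquiv.irreducible_iff (optionEquivLeft R ι)).2 hq) ?_ ?_ (s := x none)
    · rw [← hqx, hev]
    · rw [← hf, hev]
  · rintro ⟨r, rfl⟩
    rw [map_mul, hqx, zero_mul]

/-- If `c ↦ c'` extends `σ` to an isomorphism of the generated fields, then `c` and `c'` are the
images of one tuple `γ` under two embeddings of a field `K = M(γ)`. -/
theorem exists_field_of_aeval_eq_zero_iff {M : Type u} [Field M] (σ : M ≃+* M) {Ω : Type u}
    [Field Ω] [Algebra M Ω] {ι : Type} (c c' : ι → Ω)
    (hcc : ∀ f : MvPolynomial ι M, aeval c f = 0 ↔ aeval c' (map (σ : M →+* M) f) = 0) :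
    ∃ (K : Type u) (_ : Field K) (_ : Algebra M K) (Ψ : K →ₐ[M] Ω) (Ψ' : K →+* Ω) (γ : ι → K),
      (∀ m, Ψ' (algebraMap M K m) = algebraMap M Ω (σ m)) ∧ (∀ k, Ψ (γ k) = c k) ∧
      (∀ k, Ψ' (γ k) = c' k) ∧ IntermediateField.adjoin M (Set.range γ) = ⊤ := by
  let P : Ideal (MvPolynomial ι M) := RingHom.ker (aeval (R := M) c)
  have : P.IsPrime := RingHom.ker_isPrime _
  let A := MvPolynomial ι M ⧸ P
  let φ : A →ₐ[M] Ω := Ideal.Quotient.liftₐ P (aeval c) fun a ha => ha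
  let ψ : A →+* Ω := Ideal.Quotient.lift P
    (((aeval c' : MvPolynomial ι M →ₐ[M] Ω) : _ →+* Ω).comp (map (σ : M →+* M)))
    fun a ha => (hcc a).1 ha
  have hφ : Function.Injective φ := by
    rw [injective_iff_map_eq_zero]
    intro a ha
    obtain ⟨f, rfl⟩ := Ideal.Quotient.mk_surjective a
    exact Ideal.Quotient.eq_zero_iff_mem.2 ha
  have hψ : Function.Injective ψ := by
    rw [injective_iff_map_eq_zero]
    intro a ha
    obtain ⟨f, rfl⟩ := Ideal.Quotient.mk_surjective a
    exact Ideal.Quotient.eq_zero_iff_mem.2 ((hcc f).2 ha)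
  refine ⟨FractionRing A, inferInstance, inferInstance, IsFractionRing.liftAlgHom hφ,
    IsFractionRing.lift hψ, fun k => algebraMap A _ (Ideal.Quotient.mk P (X k)), ?_, ?_, ?_, ?_⟩
  · intro m
    rw [IsScalarTower.algebraMap_apply M A (FractionRing A), IsFractionRing.lift_algebraMap]
    change aeval c' (map (σ : M →+* M) (C m)) = _
    simp
  · intro k
    rw [IsFractionRing.liftAlgHom_apply, IsFractionRing.lift_algebraMap]
    exact aeval_X c k
  · intro k
    rw [IsFractionRing.lift_algebraMap]
    change aeval c' (map (σ : M →+* M) (X k)) = _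
    simp
  · rw [eq_top_iff]
    intro z _
    obtain ⟨a, b, _, rfl⟩ := IsFractionRing.div_surjective (A := A) z
    rw [IntermediateField.mem_adjoin_range_iff]
    have hmk : ∀ f : MvPolynomial ι M,
        aeval (fun k => algebraMap A (FractionRing A) (Ideal.Quotient.mk P (X k))) f =
          algebraMap A (FractionRing A) (Ideal.Quotient.mk P f) := by
      intro f
      have : (aeval fun k => algebraMap A (FractionRing A) (Ideal.Quotient.mk P (X k))) =
          (IsScalarTower.toAlgHom M A (FractionRing A)).comp (Ideal.Quotient.mkₐ M P) := by
        ext k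
        simp only [aeval_X]
        rfl
      exact DFunLike.congr_fun this f
    obtain ⟨f, rfl⟩ := Ideal.Quotient.mk_surjective a
    obtain ⟨g, rfl⟩ := Ideal.Quotient.mk_surjective b
    exact ⟨f, g, by rw [hmk, hmk]⟩

theorem ringHom_aeval_of_semilinear {M K Ω ι : Type*} [Field M] [CommRing K] [CommRing Ω]
    [Algebra M K] [Algebra M Ω] {σ : M ≃+* M} {Ψ : K →+* Ω}
    (hΨ : ∀ m, Ψ (algebraMap M K m) = algebraMap M Ω (σ m)) (δ : ι → K) (p : MvPolynomial ι M) :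
    Ψ (aeval δ p) = aeval (fun k => Ψ (δ k)) (map (σ : M →+* M) p) := by
  rw [aeval_def, aeval_def, hom_eval₂, eval₂_map]
  congr 1
  exact RingHom.ext hΨ

/-- If `x ↦ x'` extends `σ` to an isomorphism of the generated fields, so does `c ↦ c'` whenever
`c` and `c'` are given by the same rational functions of `x` and `x'`, up to `σ`. -/
theorem aeval_eq_zero_iff_of_rational {M : Type u} [Field M] (σ : M ≃+* M) {Ω : Type u}
    [Field Ω] [Algebra M Ω] {ι κ : Type} {x x' : ι → Ω} {c c' : κ → Ω}
    (hxx : ∀ f : MvPolynomial ι M, aeval x f = 0 ↔ aeval x' (map (σ : M →+* M) f) = 0)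
    (num den : κ → MvPolynomial ι M) (hden : ∀ k, aeval x (den k) ≠ 0)
    (hc : ∀ k, c k * aeval x (den k) = aeval x (num k))
    (hc' : ∀ k, c' k * aeval x' (map (σ : M →+* M) (den k)) =
      aeval x' (map (σ : M →+* M) (num k)))
    (f : MvPolynomial κ M) : aeval c f = 0 ↔ aeval c' (map (σ : M →+* M) f) = 0 := by
  obtain ⟨K, _, _, Ψ, Ψ', γ, hΨ', hγ, hγ', -⟩ := exists_field_of_aeval_eq_zero_iff σ x x' hxx
  have hΨf : ∀ {τ : Type} (δ : τ → K) (p : MvPolynomial τ M),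
      Ψ (aeval δ p) = aeval (fun k => Ψ (δ k)) p := fun δ p => by
    rw [← AlgHom.comp_apply, comp_aeval]
  let δ : κ → K := fun k => aeval γ (num k) / aeval γ (den k)
  have hx : (fun k => Ψ (γ k)) = x := funext hγ
  have hx' : (fun k => Ψ' (γ k)) = x' := funext hγ'
  have hδ : (fun k => Ψ (δ k)) = c := by
    funext k
    rw [map_div₀, hΨf, hΨf, hx, div_eq_iff (hden k), hc]
  have hδ' : (fun k => Ψ' (δ k)) = c' := by
    funext k
    rw [map_div₀, ringHom_aeval_of_semilinear hΨ', ringHom_aeval_of_semilinear hΨ', hx',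
      div_eq_iff (mt (hxx _).2 (hden k)), hc']
  rw [← hδ, ← hδ', ← hΨf, ← ringHom_aeval_of_semilinear hΨ', map_eq_zero_iff Ψ Ψ.injective,
    map_eq_zero_iff _ Ψ'.injective]

/-! ### Transcendence bases in an ultrapower -/

/-- A finitely generated extension of a perfect field is the function field of a hypersurface. -/
theorem exists_transcendenceBasis_adjoin_eq_top (k K : Type*) [Field k] [Field K] [Algebra k K]
    [PerfectField k] [Algebra.EssFiniteType k K] :
    ∃ (d : ℕ) (x : Option (Fin d) → K), IsTranscendenceBasis k (fun j => x (some j)) ∧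
      IntermediateField.adjoin k (Set.range x) = ⊤ := by
  obtain ⟨s, hs, hsep⟩ := exists_isTranscendenceBasis_and_isSeparable_of_perfectField k K
  have : Algebra.EssFiniteType (IntermediateField.adjoin k (s : Set K)) K :=
    Algebra.EssFiniteType.of_comp k _ _
  have : Algebra.FormallyUnramified (IntermediateField.adjoin k (s : Set K)) K :=
    (Algebra.FormallyUnramified.iff_isSeparable _ _).2 hsep
  have : Module.Finite (IntermediateField.adjoin k (s : Set K)) K :=
    Algebra.FormallyUnramified.finite_of_free _ _
  obtain ⟨θ, hθ⟩ := Field.exists_primitive_element (IntermediateField.adjoin k (s : Set K)) K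
  refine ⟨s.card, fun o => o.elim θ fun j => (s.equivFin.symm j : K), ?_, ?_⟩
  · exact hs.comp_equiv s.equivFin.symm
  · have hrange : Set.range
        (fun o : Option (Fin s.card) => o.elim θ fun j => (s.equivFin.symm j : K)) =
          (s : Set K) ∪ {θ} := by
      ext z
      constructor
      · rintro ⟨_ | j, rfl⟩
        · exact Or.inr rfl
        · exact Or.inl (s.equivFin.symm j).2
      · rintro (hz | rfl)
        · exact ⟨some (s.equivFin ⟨z, hz⟩), by simp⟩
        · exact ⟨none, rfl⟩
    rw [hrange, ← IntermediateField.adjoin_adjoin_left, hθ, IntermediateField.restrictScalars_top]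

section Independence

variable {I : Type*} (U : Ultrafilter I) {M : Type u} {Ω : Type u} [Field M] [Field Ω] [Algebra M Ω]

theorem algebraicIndependent_germ {ι : Type*} {T : ι → Ω} (hT : AlgebraicIndependent M T) :
    AlgebraicIndependent (Germ (U : Filter I) M)
      (fun j => ((fun _ => T j : I → Ω) : Germ (U : Filter I) Ω)) := by
  rw [algebraicIndependent_iff]
  intro p hp
  obtain ⟨P, rfl⟩ := polyGerm_surjective U p
  rw [aeval_polyGerm_eq_zero_iff] at hp
  rw [polyGerm_eq_zero_iff]
  filter_upwards [hp] with i hi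
  exact algebraicIndependent_iff.1 hT _ hi

/-- Let `T` be a finite transcendence basis of `Ω / M`. A tuple of the ultrapower of `Ω` that is
algebraically independent over the ultrapower of `M` is so in almost all coordinates, provided it
is algebraic over the diagonal copy of `T`. Indeed the tuple then extends by elements of `T` to a
basis of the same size as `T`, the algebraic dependence of `T` on this basis holds in almost all
coordinates, and a spanning set of the size of the transcendence degree is independent. -/
theorem eventually_algebraicIndependent {e d : ℕ} {T : Fin e → Ω} (hT : IsTranscendenceBasis M T)
    (τ : Fin d → I → Ω)
    (hτ : AlgebraicIndependent (Germ (U : Filter I) M)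
      (fun k => (τ k : Germ (U : Filter I) Ω)))
    (halg : ∀ k, IsAlgebraic (Algebra.adjoin (Germ (U : Filter I) M)
      (Set.range fun j => ((fun _ => T j : I → Ω) : Germ (U : Filter I) Ω)))
        (τ k : Germ (U : Filter I) Ω)) :
    ∀ᶠ i in (U : Filter I), AlgebraicIndependent M (fun k => τ k i) := by
  let M' := Germ (U : Filter I) M
  let Ω' := Germ (U : Filter I) Ω
  let T' : Fin e → Ω' := fun j => ((fun _ => T j : I → Ω) : Germ (U : Filter I) Ω)
  let τ' : Fin d → Ω' := fun k => (τ k : Germ (U : Filter I) Ω)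
  have hT' : AlgebraicIndependent M' T' := algebraicIndependent_germ U hT.1
  have hMinj : Function.Injective (algebraMap M Ω) := (algebraMap M Ω).injective
  have : FaithfulSMul M' Ω' := (faithfulSMul_iff_algebraMap_injective _ _).2
    (algebraMap M' Ω').injective
  let m := AlgebraicIndependent.matroid M' Ω'
  have hTind : m.Indep (Set.range T') :=
    AlgebraicIndependent.matroid_indep_iff.2 hT'.to_subtype_range
  have hτind : m.Indep (Set.range τ') :=
    AlgebraicIndependent.matroid_indep_iff.2 hτ.to_subtype_range
  obtain ⟨J, hJ, hτJ⟩ := hτind.subset_isBasis_of_subset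
    (Set.subset_union_left (t := Set.range T')) (Set.subset_univ _)
  have hTbasis : m.IsBasis (Set.range T') (Set.range τ' ∪ Set.range T') := by
    refine AlgebraicIndependent.matroid_isBasis_iff.2 ⟨hT'.to_subtype_range,
      Set.subset_union_right, ?_⟩
    rintro a (⟨k, rfl⟩ | ⟨j, rfl⟩)
    · exact halg k
    · exact isAlgebraic_algebraMap
        (⟨T' j, Algebra.subset_adjoin ⟨j, rfl⟩⟩ : Algebra.adjoin M' (Set.range T'))
  have hcard : J.encard = e := by
    rw [hJ.encard_eq_encard hTbasis, ← Set.image_univ, hT'.injective.encard_image,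
      Set.encard_univ]
    simp
  have hJfin : J.Finite := Set.finite_of_encard_eq_coe hcard
  have := hJfin.to_subtype
  choose b hb using fun a : J => Quotient.exists_rep a.1
  have hb' : ∀ a : J, ((b a : I → Ω) : Germ (U : Filter I) Ω) = a.1 := hb
  have hrange : (Set.range fun a : J => ((b a : I → Ω) : Germ (U : Filter I) Ω)) = J := by
    simp_rw [hb']
    exact Subtype.range_coe
  have h1 : ∀ᶠ i in (U : Filter I), ∀ j, IsAlgebraic
      (Algebra.adjoin M (Set.range fun a => b a i)) (T j) := by
    rw [eventually_all]
    intro j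
    refine eventually_isAlgebraic_adjoin U b (fun _ => T j) ?_
    rw [hrange]
    exact (AlgebraicIndependent.matroid_isBasis_iff.1 hJ).2.2 _ (Or.inr ⟨j, rfl⟩)
  have h2 : ∀ᶠ i in (U : Filter I), ∀ k, τ k i = b ⟨τ' k, hτJ ⟨k, rfl⟩⟩ i := by
    rw [eventually_all]
    intro k
    exact Germ.coe_eq.1 (hb' ⟨τ' k, hτJ ⟨k, rfl⟩⟩).symm
  filter_upwards [h1, h2] with i hi1 hi2
  have : FaithfulSMul M Ω := (faithfulSMul_iff_algebraMap_injective _ _).2 hMinj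
  have hspan : (AlgebraicIndependent.matroid M Ω).Spanning (Set.range fun a => b a i) := by
    have hTs : (AlgebraicIndependent.matroid M Ω).Spanning (Set.range T) :=
      AlgebraicIndependent.matroid_spanning_iff.2 hT.isAlgebraic
    rw [Matroid.spanning_iff_closure_eq (Set.subset_univ _)]
    refine Set.Subset.antisymm (Matroid.closure_subset_ground _ _) ?_
    rw [← hTs.closure_eq]
    refine Matroid.closure_subset_closure_of_subset_closure ?_
    rintro _ ⟨j, rfl⟩
    rw [AlgebraicIndependent.matroid_closure_eq]
    exact hi1 j
  have := AlgebraicIndependent.matroid_spanning_iff.1 hspan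
  have hbasis : IsTranscendenceBasis M (fun a : J => b a i) := by
    refine Algebra.IsAlgebraic.isTranscendenceBasis_of_lift_le_trdeg_of_finite M _ ?_
    have htrdeg : Algebra.trdeg M Ω = e := by
      simpa using hT.lift_cardinalMk_eq_trdeg.symm
    have hJcard : Cardinal.mk J = e := by
      rw [← Set.cast_ncard hJfin, Set.ncard_def, hcard, ENat.toNat_natCast]
    rw [htrdeg, hJcard, Cardinal.lift_natCast, Cardinal.lift_natCast]
  have heq : (fun k => τ k i) = (fun a : J => b a i) ∘ fun k => ⟨τ' k, hτJ ⟨k, rfl⟩⟩ :=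
    funext hi2
  rw [heq]
  exact hbasis.1.comp _ fun k l hkl => hτ.injective (congrArg Subtype.val hkl)

end Independence

/-! ### Isomorphism types of tuples in an ultrapower -/

theorem isAlgebraic_aeval {R S Ω ι : Type*} [Field R] [Field Ω] [CommRing S] [IsDomain S]
    [Algebra R S] [Algebra R Ω] [Algebra S Ω] [IsScalarTower R S Ω] {c : ι → Ω}
    (hc : ∀ k, IsAlgebraic S (c k)) (f : MvPolynomial ι R) : IsAlgebraic S (aeval c f) := by
  induction f using MvPolynomial.induction_on with
  | C a =>
    rw [aeval_C, IsScalarTower.algebraMap_apply R S Ω]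
    exact isAlgebraic_algebraMap _
  | add p q hp hq =>
    rw [map_add]
    exact hp.add hq
  | mul_X p k hp =>
    rw [map_mul, aeval_X]
    exact hp.mul (hc k)

theorem exists_mul_aeval_eq_aeval {k K ι : Type*} [Field k] [Field K] [Algebra k K] {x : ι → K}
    (hx : IntermediateField.adjoin k (Set.range x) = ⊤) (z : K) :
    ∃ r s : MvPolynomial ι k, aeval x s ≠ 0 ∧ z * aeval x s = aeval x r := by
  obtain ⟨r, s, hz⟩ := (IntermediateField.mem_adjoin_range_iff k x z).1
    (hx ▸ IntermediateField.mem_top)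
  by_cases hs : aeval x s = 0
  · exact ⟨0, 1, by simp, by simp [hz, hs]⟩
  · exact ⟨r, s, hs, by rw [hz, div_mul_cancel₀ _ hs]⟩

theorem exists_irreducible_aeval_eq_zero {k K : Type*} [Field k] [Field K] [Algebra k K] {ι : Type*}
    {x : Option ι → K} (hx : IsTranscendenceBasis k (fun j => x (some j))) :
    ∃ q : MvPolynomial (Option ι) k, Irreducible q ∧ aeval x q = 0 := by
  have hne : RingHom.ker (aeval (R := k) x) ≠ ⊥ := by
    intro hbot
    have hind : AlgebraicIndependent k x := (RingHom.injective_iff_ker_eq_bot _).2 hbot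
    have hnone : x none ∈ Set.range fun j => x (some j) := by
      rw [hx.2 (Set.range x) hind.to_subtype_range (by rintro _ ⟨j, rfl⟩; exact ⟨some j, rfl⟩)]
      exact ⟨none, rfl⟩
    obtain ⟨j, hj⟩ := hnone
    exact Option.some_ne_none j (hind.injective hj)
  have := RingHom.ker_isPrime (aeval (R := k) x)
  obtain ⟨q, hqmem, hq⟩ := this.exists_mem_prime_of_ne_bot hne
  exact ⟨q, hq.irreducible, hqmem⟩

/-- Generic points of an irreducible hypersurface and of its conjugate under `σ` satisfy the same
polynomials, up to `σ`. -/
theorem aeval_eq_zero_iff_of_hypersurface {M Ω ι : Type*} [Field M] [Field Ω] [Algebra M Ω]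
    (σ : M ≃+* M) {y y' : Option ι → Ω} (hy : AlgebraicIndependent M fun k => y (some k))
    (hy' : AlgebraicIndependent M fun k => y' (some k)) {q : MvPolynomial (Option ι) M}
    (hq : Irreducible q) (hqy : aeval y q = 0) (hqy' : aeval y' (map (σ : M →+* M) q) = 0)
    (f : MvPolynomial (Option ι) M) :
    aeval y f = 0 ↔ aeval y' (map (σ : M →+* M) f) = 0 := by
  have hirr : Irreducible (map (σ : M →+* M) q) :=
    (MulEquiv.irreducible_iff (mapEquiv (Option ι) σ)).2 hq
  rw [aeval_eq_zero_iff_dvd hy hq hqy, aeval_eq_zero_iff_dvd hy' hirr hqy']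
  exact (map_dvd_iff (mapEquiv (Option ι) σ)).symm

section Descent

variable {I : Type u} (U : Ultrafilter I) {M Ω : Type u} [Field M] [Field Ω] [Algebra M Ω]

/-- If `c ↦ c'` extends the ultrapower of `σ` to an isomorphism of the generated fields, then in
almost all coordinates `c(i) ↦ c'(i)` extends `σ`. The polynomials witnessing a failure could have
unbounded degree, so this is not a formal transfer; but the generated field is the function field
of a hypersurface, whose equation remains irreducible and determines the ideal of its generic
point in almost all coordinates. -/
theorem eventually_aeval_eq_zero_iff [IsAlgClosed M] (σ : M ≃+* M) {e n : ℕ} {T : Fin e → Ω}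
    (hT : IsTranscendenceBasis M T) (c c' : Fin n → I → Ω)
    (hcc : ∀ f : MvPolynomial (Fin n) (Germ (U : Filter I) M),
      aeval (fun k => (c k : Germ (U : Filter I) Ω)) f = 0 ↔
        aeval (fun k => (c' k : Germ (U : Filter I) Ω))
          (map (germEquiv U σ : Germ (U : Filter I) M →+* Germ (U : Filter I) M) f) = 0)
    (hc : ∀ k, IsAlgebraic (Algebra.adjoin (Germ (U : Filter I) M)
      (Set.range fun j => ((fun _ => T j : I → Ω) : Germ (U : Filter I) Ω)))
        (c k : Germ (U : Filter I) Ω))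
    (hc' : ∀ k, IsAlgebraic (Algebra.adjoin (Germ (U : Filter I) M)
      (Set.range fun j => ((fun _ => T j : I → Ω) : Germ (U : Filter I) Ω)))
        (c' k : Germ (U : Filter I) Ω)) :
    ∀ᶠ i in (U : Filter I), ∀ f : MvPolynomial (Fin n) M,
      aeval (fun k => c k i) f = 0 ↔ aeval (fun k => c' k i) (map (σ : M →+* M) f) = 0 := by
  classical
  obtain ⟨K, _, _, Ψ, Ψ', γ, hΨ', hγ, hγ', hγtop⟩ :=
    exists_field_of_aeval_eq_zero_iff (germEquiv U σ) _ _ hcc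
  have hγ₁ : (fun k => Ψ (γ k)) = fun k => (c k : Germ (U : Filter I) Ω) := funext hγ
  have hγ₂ : (fun k => Ψ' (γ k)) = fun k => (c' k : Germ (U : Filter I) Ω) := funext hγ'
  have hΨaeval : ∀ {κ : Type} (δ : κ → K) (p : MvPolynomial κ (Germ (U : Filter I) M)),
      Ψ (aeval δ p) = aeval (fun k => Ψ (δ k)) p := fun δ p => by
    rw [← AlgHom.comp_apply, comp_aeval]
  have hsurj : Function.Surjective (fun p : MvPolynomial (Fin n) (Germ (U : Filter I) M) =>
      map (germEquiv U σ : Germ (U : Filter I) M →+* Germ (U : Filter I) M) p) :=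
    map_surjective _ (germEquiv U σ).surjective
  -- both images of `K` are algebraic over `T`
  have halg : ∀ z, IsAlgebraic (Algebra.adjoin (Germ (U : Filter I) M)
      (Set.range fun j => ((fun _ => T j : I → Ω) : Germ (U : Filter I) Ω))) (Ψ z) := by
    intro z
    obtain ⟨r, s, hs, hz⟩ := exists_mul_aeval_eq_aeval hγtop z
    rw [← eq_div_iff hs] at hz
    rw [hz, map_div₀, hΨaeval, hΨaeval, hγ₁, div_eq_mul_inv]
    exact (isAlgebraic_aeval hc r).mul (isAlgebraic_aeval hc s).inv
  have halg' : ∀ z, IsAlgebraic (Algebra.adjoin (Germ (U : Filter I) M)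
      (Set.range fun j => ((fun _ => T j : I → Ω) : Germ (U : Filter I) Ω))) (Ψ' z) := by
    intro z
    obtain ⟨r, s, hs, hz⟩ := exists_mul_aeval_eq_aeval hγtop z
    rw [← eq_div_iff hs] at hz
    rw [hz, map_div₀, ringHom_aeval_of_semilinear hΨ', ringHom_aeval_of_semilinear hΨ', hγ₂,
      div_eq_mul_inv]
    exact (isAlgebraic_aeval hc' _).mul (isAlgebraic_aeval hc' _).inv
  have : Algebra.EssFiniteType (Germ (U : Filter I) M) K :=
    IntermediateField.fg_top_iff.1 ⟨Finset.univ.image γ, by simpa using hγtop⟩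
  obtain ⟨d, x, hx, hxtop⟩ := exists_transcendenceBasis_adjoin_eq_top (Germ (U : Filter I) M) K
  obtain ⟨q, hq, hqx⟩ := exists_irreducible_aeval_eq_zero hx
  choose num den hden hnd using fun k => exists_mul_aeval_eq_aeval hxtop (γ k)
  -- representatives of all the data
  choose y hy using fun o => Quotient.exists_rep (Ψ (x o))
  choose y' hy' using fun o => Quotient.exists_rep (Ψ' (x o))
  replace hy : (fun o => Ψ (x o)) = fun o => (y o : Germ (U : Filter I) Ω) :=
    funext fun o => (hy o).symm
  replace hy' : (fun o => Ψ' (x o)) = fun o => (y' o : Germ (U : Filter I) Ω) :=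
    funext fun o => (hy' o).symm
  obtain ⟨Q, rfl⟩ := polyGerm_surjective U q
  obtain ⟨Q', hQ'g, hQ'⟩ := map_germEquiv_polyGerm U σ Q
  choose N hN using fun k => polyGerm_surjective U (num k)
  choose D hD using fun k => polyGerm_surjective U (den k)
  choose N' hN'g hN' using fun k => map_germEquiv_polyGerm U σ (N k)
  choose D' hD'g hD' using fun k => map_germEquiv_polyGerm U σ (D k)
  have hind : AlgebraicIndependent (Germ (U : Filter I) M)
      (fun k => (y (some k) : Germ (U : Filter I) Ω)) := by
    have := hx.1.map' (f := Ψ) Ψ.injective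
    have h2 : (Ψ ∘ fun j => x (some j)) = fun k => (y (some k) : Germ (U : Filter I) Ω) :=
      funext fun k => congrFun hy (some k)
    rwa [h2] at this
  have hind' : AlgebraicIndependent (Germ (U : Filter I) M)
      (fun k => (y' (some k) : Germ (U : Filter I) Ω)) := by
    have h2 : (fun k => (y' (some k) : Germ (U : Filter I) Ω)) = fun k => Ψ' (x (some k)) :=
      funext fun k => (congrFun hy' (some k)).symm
    rw [h2, algebraicIndependent_iff]
    intro p hp
    obtain ⟨p, rfl⟩ := map_surjective (σ := Fin d)
      (germEquiv U σ : Germ (U : Filter I) M →+* Germ (U : Filter I) M) (germEquiv U σ).surjective p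
    rw [← ringHom_aeval_of_semilinear hΨ', map_eq_zero_iff _ Ψ'.injective] at hp
    rw [algebraicIndependent_iff.1 hx.1 p hp, map_zero]
  have hindep := eventually_algebraicIndependent U hT (fun k => y (some k)) hind fun k => by
    rw [← congrFun hy (some k)]; exact halg _
  have hindep_conj := eventually_algebraicIndependent U hT (fun k => y' (some k)) hind' fun k => by
    rw [← congrFun hy' (some k)]; exact halg' _
  have hirr := eventually_irreducible U hq
  have hQy : ∀ᶠ i in (U : Filter I), aeval (fun o => y o i) (polyAt i _ M Q) = 0 := by
    rw [← aeval_polyGerm_eq_zero_iff, ← hy, ← hΨaeval, hqx, map_zero]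
  have hQy_conj : ∀ᶠ i in (U : Filter I), aeval (fun o => y' o i) (polyAt i _ M Q') = 0 := by
    rw [← aeval_polyGerm_eq_zero_iff, ← hy', ← hQ'g, ← ringHom_aeval_of_semilinear hΨ', hqx,
      map_zero]
  have hden_ne : ∀ᶠ i in (U : Filter I), ∀ k, aeval (fun o => y o i) (polyAt i _ M (D k)) ≠ 0 := by
    rw [eventually_all]
    intro k
    rw [Ultrafilter.eventually_not, ← aeval_polyGerm_eq_zero_iff, ← hy, ← hΨaeval, hD,
      map_eq_zero_iff Ψ Ψ.injective]
    exact hden k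
  have hcy : ∀ᶠ i in (U : Filter I), ∀ k,
      c k i * aeval (fun o => y o i) (polyAt i _ M (D k)) =
        aeval (fun o => y o i) (polyAt i _ M (N k)) := by
    rw [eventually_all]
    intro k
    have h := congrArg Ψ (hnd k)
    rw [map_mul, hΨaeval, hΨaeval, hy, hγ, ← hD, ← hN, aeval_polyGerm, aeval_polyGerm] at h
    exact Germ.coe_eq.1 h
  have hcy_conj : ∀ᶠ i in (U : Filter I), ∀ k,
      c' k i * aeval (fun o => y' o i) (polyAt i _ M (D' k)) =
        aeval (fun o => y' o i) (polyAt i _ M (N' k)) := by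
    rw [eventually_all]
    intro k
    have h := congrArg Ψ' (hnd k)
    rw [map_mul, ringHom_aeval_of_semilinear hΨ', ringHom_aeval_of_semilinear hΨ', hy', hγ', ← hD,
      ← hN, hN'g, hD'g, aeval_polyGerm, aeval_polyGerm] at h
    exact Germ.coe_eq.1 h
  filter_upwards [hindep, hindep_conj, hirr, hQy, hQy_conj, hden_ne, hcy,
    hcy_conj] with i h1 h2 h3 h4 h5 h6 h7 h8
  rw [hQ'] at h5
  simp only [hN', hD'] at h8
  have hyy := aeval_eq_zero_iff_of_hypersurface (y := fun o => y o i) (y' := fun o => y' o i)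
    (q := polyAt i _ M Q) σ h1 h2 h3 h4 h5
  exact aeval_eq_zero_iff_of_rational (x := fun o => y o i) (x' := fun o => y' o i) σ hyy
    (fun k => polyAt i _ M (N k)) (fun k => polyAt i _ M (D k)) h6 h7 h8

end Descent

/-! ### Ultrapowers of existentially closed difference fields -/

/-- A finitely generated field extension of the ultrapower of `M` embeds in the ultrapower of an
algebraically closed field `Ω` of finite transcendence degree over `M`, in such a way that a
transcendence basis becomes the diagonal copy of a transcendence basis of `Ω`. -/
theorem exists_algHom_germ {I : Type u} (U : Ultrafilter I) {M : Type u} [Field M] [IsAlgClosed M]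
    (L : Type u) [Field L] [Algebra (Germ (U : Filter I) M) L]
    [Algebra.EssFiniteType (Germ (U : Filter I) M) L] :
    ∃ (Ω : Type u) (_ : Field Ω) (_ : Algebra M Ω) (e : ℕ) (T : Fin e → Ω)
      (ρ : L →ₐ[Germ (U : Filter I) M] Germ (U : Filter I) Ω), IsTranscendenceBasis M T ∧
        ∀ z, IsAlgebraic (Algebra.adjoin (Germ (U : Filter I) M)
          (Set.range fun j => ((fun _ => T j : I → Ω) : Germ (U : Filter I) Ω))) (ρ z) := by
  obtain ⟨e, x, hx, -⟩ := exists_transcendenceBasis_adjoin_eq_top (Germ (U : Filter I) M) L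
  let b : Fin e → L := fun j => x (some j)
  have hb : AlgebraicIndependent (Germ (U : Filter I) M) b := hx.1
  let F := FractionRing (MvPolynomial (Fin e) M)
  let Ω := AlgebraicClosure F
  let T : Fin e → Ω := fun j => algebraMap F Ω (algebraMap (MvPolynomial (Fin e) M) F (X j))
  have hT : IsTranscendenceBasis M T := by
    have h1 : IsTranscendenceBasis M (X : Fin e → MvPolynomial (Fin e) M) :=
      IsTranscendenceBasis.mvPolynomial _ _
    have : Algebra.IsAlgebraic (MvPolynomial (Fin e) M) F :=
      IsLocalization.isAlgebraic _ (nonZeroDivisors (MvPolynomial (Fin e) M))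
    have h2 := h1.algebraMap_comp (A := F)
    exact h2.algebraMap_comp (A := Ω)
  let T' : Fin e → Germ (U : Filter I) Ω := fun j =>
    ((fun _ => T j : I → Ω) : Germ (U : Filter I) Ω)
  have hT' : AlgebraicIndependent (Germ (U : Filter I) M) T' := algebraicIndependent_germ U hT.1
  let L₁ := IntermediateField.adjoin (Germ (U : Filter I) M) (Set.range b)
  let φ : L₁ →ₐ[Germ (U : Filter I) M] Germ (U : Filter I) Ω :=
    (IsFractionRing.liftAlgHom (algebraicIndependent_iff_injective_aeval.2 hT')).comp hb.reprField
  have hφ : ∀ j (h : b j ∈ L₁), φ ⟨b j, h⟩ = T' j := by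
    intro j h
    have h1 : hb.reprField ⟨b j, h⟩ =
        algebraMap (MvPolynomial (Fin e) (Germ (U : Filter I) M)) _ (X j) := by
      refine (IsFractionRing.lift (algebraicIndependent_iff_injective_aeval.2 hb)).injective ?_
      exact (hb.lift_reprField _).trans
        ((IsFractionRing.lift_algebraMap _ _).trans (aeval_X b j)).symm
    refine (congrArg (IsFractionRing.liftAlgHom
      (algebraicIndependent_iff_injective_aeval.2 hT')) h1).trans ?_
    exact (IsFractionRing.lift_algebraMap (algebraicIndependent_iff_injective_aeval.2 hT')
      (X j)).trans (aeval_X T' j)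
  let _ : Algebra L₁ (Germ (U : Filter I) Ω) := φ.toRingHom.toAlgebra
  have : Algebra.IsAlgebraic L₁ L := hx.isAlgebraic_field
  let ρ₀ : L →ₐ[L₁] Germ (U : Filter I) Ω := IsAlgClosed.lift
  have hρ₀ : ∀ y : L₁, ρ₀ (y : L) = φ y := fun y => ρ₀.commutes y
  let ρ : L →ₐ[Germ (U : Filter I) M] Germ (U : Filter I) Ω :=
    { ρ₀ with
      commutes' := fun r => by
        have := hρ₀ (algebraMap _ L₁ r)
        rw [φ.commutes] at this
        exact this }
  refine ⟨Ω, inferInstance, inferInstance, e, T, ρ, hT, fun z => ?_⟩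
  have hρb : ρ '' Set.range b = Set.range T' := by
    rw [← Set.range_comp]
    congr 1
    funext j
    exact (hρ₀ ⟨b j, IntermediateField.subset_adjoin _ _ ⟨j, rfl⟩⟩).trans (hφ j _)
  have hz : IsAlgebraic (Algebra.adjoin (Germ (U : Filter I) M) (Set.range b)) z :=
    hx.isAlgebraic.isAlgebraic z
  let f : Algebra.adjoin (Germ (U : Filter I) M) (Set.range b) →ₐ[Germ (U : Filter I) M]
      Algebra.adjoin (Germ (U : Filter I) M) (Set.range T') :=
    (ρ.comp (Subalgebra.val _)).codRestrict _ fun y => by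
      rw [← hρb, ← AlgHom.map_adjoin]
      exact ⟨y, y.2, rfl⟩
  have hf : Function.Injective f := fun y₁ y₂ h =>
    Subtype.ext (ρ.injective (congrArg Subtype.val h))
  exact hz.ringHom_of_comp_eq f ρ hf rfl

theorem eval_polyGerm {I : Type*} (U : Ultrafilter I) {R ι : Type*} [Field R] (x : ι → I → R)
    (F : MvPolynomial ι (I → R)) :
    eval (fun k => (x k : Germ (U : Filter I) R)) (polyGerm U ι R F) =
      ((fun i => eval (fun k => x k i) (polyAt i ι R F) : I → R) : Germ (U : Filter I) R) := by
  have h := aeval_polyGerm U (Ω := R) x F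
  have hid : germAlgebra U (R := R) (Ω := R) = Algebra.id _ :=
    Algebra.algebra_ext _ _ fun a => a.inductionOn fun _ => rfl
  rw [hid] at h
  exact h

/-- A solution of a system over the ultrapower in an extension generates a finitely generated
extension, which embeds in the ultrapower of an extension `Ω` of `M`. In almost all coordinates this
gives a solution in `Ω` of the system in that coordinate, hence one in `M`. -/
theorem IsExistentiallyClosed.germ {I : Type u} (U : Ultrafilter I) {M : Type u} [Field M]
    [IsAlgClosed M] {σ : M ≃+* M} (hM : IsExistentiallyClosed σ) :
    IsExistentiallyClosed (germEquiv U σ) := by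
  classical
  intro Ω' _ _ n c c' hcc Φ g hΦ hg
  let L := IntermediateField.adjoin (Germ (U : Filter I) M) (Set.range c ∪ Set.range c')
  have : Algebra.EssFiniteType (Germ (U : Filter I) M) L :=
    IntermediateField.essFiniteType_iff.2 ⟨Finset.univ.image c ∪ Finset.univ.image c', by simp [L]⟩
  let c₁ : Fin n → L := fun k => ⟨c k, IntermediateField.subset_adjoin _ _ (Or.inl ⟨k, rfl⟩)⟩
  let c₁' : Fin n → L := fun k => ⟨c' k, IntermediateField.subset_adjoin _ _ (Or.inr ⟨k, rfl⟩)⟩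
  obtain ⟨Ω, _, _, e, T, ρ, hT, hρ⟩ := exists_algHom_germ U (M := M) L
  -- solving over `L` is the same as solving over `Ω'` or over the ultrapower of `Ω`
  have hval : ∀ {ι : Type} (x : ι → L) (f : MvPolynomial ι (Germ (U : Filter I) M)),
      aeval (fun k => (x k : Ω')) f = 0 ↔ aeval (fun k => ρ (x k)) f = 0 := by
    intro ι x f
    have h1 : aeval (fun k => (x k : Ω')) f = L.val (aeval x f) := by
      rw [← AlgHom.comp_apply, comp_aeval]
      rfl
    have h2 : aeval (fun k => ρ (x k)) f = ρ (aeval x f) := by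
      rw [← AlgHom.comp_apply, comp_aeval]
    rw [h1, h2, map_eq_zero_iff L.val L.val.injective, map_eq_zero_iff ρ ρ.injective]
  choose w hw using fun k => Quotient.exists_rep (ρ (c₁ k))
  choose w' hw' using fun k => Quotient.exists_rep (ρ (c₁' k))
  replace hw : ∀ k, ρ (c₁ k) = (w k : Germ (U : Filter I) Ω) := fun k => (hw k).symm
  replace hw' : ∀ k, ρ (c₁' k) = (w' k : Germ (U : Filter I) Ω) := fun k => (hw' k).symm
  have hfib := eventually_aeval_eq_zero_iff U σ hT w w'
    (fun f => by
      have h1 := hval c₁ f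
      have h2 := hval c₁' (map (germEquiv U σ : Germ (U : Filter I) M →+* Germ (U : Filter I) M) f)
      simp only [hw, hw'] at h1 h2
      rw [← h1, ← h2]
      exact hcc f)
    (fun k => hw k ▸ hρ (c₁ k)) (fun k => hw' k ▸ hρ (c₁' k))
  have hsum : ∀ f : MvPolynomial (Fin n ⊕ Fin n) (Germ (U : Filter I) M),
      aeval (Sum.elim c c') f = 0 ↔
        aeval (fun k => ((Sum.elim w w' k : I → Ω) : Germ (U : Filter I) Ω)) f = 0 := by
    intro f
    have h := hval (Sum.elim c₁ c₁') f
    have e1 : (fun k => ((Sum.elim c₁ c₁' k : L) : Ω')) = Sum.elim c c' := by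
      ext (k | k) <;> rfl
    have e2 : (fun k => ρ (Sum.elim c₁ c₁' k)) =
        fun k => ((Sum.elim w w' k : I → Ω) : Germ (U : Filter I) Ω) := by
      ext (k | k)
      · exact hw k
      · exact hw' k
    rwa [e1, e2] at h
  choose lift hlift using polyGerm_surjective (R := M) (ι := Fin n ⊕ Fin n) U
  have hsol : ∀ i, ∃ x : Fin n → M,
      (∀ f : MvPolynomial (Fin n) M,
        aeval (fun k => w k i) f = 0 ↔ aeval (fun k => w' k i) (map (σ : M →+* M) f) = 0) →
      (∀ f ∈ Φ, aeval (fun k => Sum.elim w w' k i) (polyAt i _ M (lift f)) = 0) →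
      aeval (fun k => Sum.elim w w' k i) (polyAt i _ M (lift g)) ≠ 0 →
      (∀ f ∈ Φ, eval (Sum.elim x (fun k => σ (x k))) (polyAt i _ M (lift f)) = 0) ∧
        eval (Sum.elim x (fun k => σ (x k))) (polyAt i _ M (lift g)) ≠ 0 := by
    intro i
    by_contra! hcon
    obtain ⟨h1, h2, h3, -⟩ := hcon 0
    have he : (fun k => Sum.elim w w' k i) = Sum.elim (fun k => w k i) (fun k => w' k i) := by
      ext (k | k) <;> rfl
    rw [he] at h2 h3
    obtain ⟨x, hx, hgx⟩ := hM Ω n _ _ h1 (Φ.image fun f => polyAt i _ M (lift f))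
      (polyAt i _ M (lift g)) (by simpa using h2) h3
    obtain ⟨-, -, -, h4⟩ := hcon x
    exact hgx (h4 fun f hf => hx _ (Finset.mem_image_of_mem _ hf))
  choose x hx using hsol
  have hΦ' : ∀ᶠ i in (U : Filter I), ∀ f ∈ Φ,
      aeval (fun k => Sum.elim w w' k i) (polyAt i _ M (lift f)) = 0 := by
    rw [eventually_all_finset]
    intro f hf
    rw [← aeval_polyGerm_eq_zero_iff, ← hsum, hlift]
    exact hΦ f hf
  have hg' : ∀ᶠ i in (U : Filter I),
      aeval (fun k => Sum.elim w w' k i) (polyAt i _ M (lift g)) ≠ 0 := by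
    rw [Ultrafilter.eventually_not, ← aeval_polyGerm_eq_zero_iff, ← hsum, hlift]
    exact hg
  have hall := (hfib.and (hΦ'.and hg')).mono fun i h => hx i h.1 h.2.1 h.2.2
  let ξ : Fin n → Germ (U : Filter I) M := fun k =>
    ((fun i => x i k : I → M) : Germ (U : Filter I) M)
  have hξ : ∀ f : MvPolynomial (Fin n ⊕ Fin n) (Germ (U : Filter I) M),
      eval (Sum.elim ξ (fun k => germEquiv U σ (ξ k))) f = 0 ↔
        ∀ᶠ i in (U : Filter I),
          eval (Sum.elim (x i) (fun k => σ (x i k))) (polyAt i _ M (lift f)) = 0 := by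
    intro f
    conv_lhs => rw [← hlift f]
    have e : Sum.elim ξ (fun k => germEquiv U σ (ξ k)) = fun k =>
        ((fun i => Sum.elim (x i) (fun k => σ (x i k)) k : I → M) : Germ (U : Filter I) M) := by
      ext (k | k) <;> rfl
    rw [e, eval_polyGerm]
    exact Germ.coe_eq
  refine ⟨ξ, fun f hf => (hξ f).2 (hall.mono fun i h => h.1 f hf), ?_⟩
  rw [Ne, hξ, ← Ultrafilter.eventually_not]
  exact hall.mono fun i h => h.2

/-! ### Model completeness -/

section Los

open FirstOrder Language

/-- The ultrapower of a difference field, as a structure, is the ultraproduct structure. -/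
theorem diffRingStructure_germ {I : Type*} (U : Ultrafilter I) {M : Type*} [Field M]
    (σ : M ≃+* M) :
    diffRingStructure (germEquiv U σ) =
      (letI : diffRing.Structure M := diffRingStructure σ
       (Ultraproduct.structure : diffRing.Structure ((U : Filter I).Product fun _ => M))) := by
  let _ : diffRing.Structure M := diffRingStructure σ
  apply Structure.ext
  · funext n f x
    obtain ⟨y, rfl⟩ : ∃ y : Fin n → I → M, x = fun k => (y k : Germ (U : Filter I) M) := by
      choose y hy using fun k => Quotient.exists_rep (x k)
      exact ⟨y, funext fun k => (hy k).symm⟩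
    refine Eq.trans ?_ (Ultraproduct.funMap_cast (u := U) (M := fun _ : I => M) f y).symm
    rcases f with f | f
    · cases f <;> rfl
    · cases f
      rfl
  · funext n r
    rcases r with r | r <;> exact r.elim

/-- Łoś's theorem for ultrapowers of a difference field. -/
theorem realize_germ_iff {I : Type*} (U : Ultrafilter I) {M : Type*} [Field M] (σ : M ≃+* M)
    {α : Type*} {n : ℕ} (φ : diffRing.BoundedFormula α n) (v : α → I → M) (xs : Fin n → I → M) :
    @BoundedFormula.Realize _ _ (diffRingStructure (germEquiv U σ)) _ _ φ
        (fun k => (v k : Germ (U : Filter I) M)) (fun k => (xs k : Germ (U : Filter I) M)) ↔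
      ∀ᶠ i in (U : Filter I), @BoundedFormula.Realize _ _ (diffRingStructure σ) _ _ φ
        (fun k => v k i) (fun k => xs k i) := by
  rw [diffRingStructure_germ]
  let _ : diffRing.Structure M := diffRingStructure σ
  exact Ultraproduct.boundedFormula_realize_cast (u := U) (M := fun _ : I => M) φ v xs

theorem realize_term_ringHom {M N : Type*} [Field M] [Field N] {σ : M ≃+* M} {τ : N ≃+* N}
    (h : M →+* N) (hh : ∀ a, h (σ a) = τ (h a)) {α : Type*} (t : diffRing.Term α) (v : α → M) :
    h (@Term.realize _ _ (diffRingStructure σ) _ v t) =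
      @Term.realize _ _ (diffRingStructure τ) _ (fun k => h (v k)) t := by
  induction t with
  | var k => rfl
  | func f ts ih =>
    simp only [Term.realize]
    rcases f with f | f
    · cases f
      · exact (h.map_add _ _).trans (congrArg₂ _ (ih 0) (ih 1))
      · exact (h.map_mul _ _).trans (congrArg₂ _ (ih 0) (ih 1))
      · exact (h.map_neg _).trans (congrArg _ (ih 0))
      · exact h.map_zero
      · exact h.map_one
    · cases f
      exact (hh _).trans (congrArg _ (ih 0))

/-- Embeddings between existentially closed difference fields that are algebraically closed are
elementary. This is Robinson's test: `N` embeds over `M` in an ultrapower of `M`, so a universal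
formula true in `M` is true in the ultrapower and descends to `N`. -/
theorem realize_iff_of_ringHom {α : Type*} {n : ℕ} (φ : diffRing.BoundedFormula α n)
    {M N : Type u} [Field M] [Field N] [IsAlgClosed M] [IsAlgClosed N] {σ : M ≃+* M} {τ : N ≃+* N}
    (hM : IsExistentiallyClosed σ) (hN : IsExistentiallyClosed τ) (h : M →+* N)
    (hh : ∀ a, h (σ a) = τ (h a)) (v : α → M) (xs : Fin n → M) :
    @BoundedFormula.Realize _ _ (diffRingStructure σ) _ _ φ v xs ↔
      @BoundedFormula.Realize _ _ (diffRingStructure τ) _ _ φ (fun k => h (v k))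
        (fun k => h (xs k)) := by
  induction φ generalizing M N with
  | falsum => exact Iff.rfl
  | equal t₁ t₂ =>
    have key : ∀ t, h (@Term.realize _ _ (diffRingStructure σ) _ (Sum.elim v xs) t) =
        @Term.realize _ _ (diffRingStructure τ) _
          (Sum.elim (fun k => h (v k)) (fun k => h (xs k))) t := by
      intro t
      rw [realize_term_ringHom h hh]
      congr 1
      ext (k | k) <;> rfl
    simp only [BoundedFormula.Realize]
    rw [← key, ← key]
    exact h.injective.eq_iff.symm
  | rel R ts => rcases R with R | R <;> exact R.elim
  | imp φ ψ hφ hψ =>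
    exact imp_congr (hφ hM hN h hh v xs) (hψ hM hN h hh v xs)
  | @all n ψ hψ =>
    have hsnoc : ∀ {A B : Type u} (f : A → B) (ys : Fin n → A) (a : A),
        (fun k => f ((Fin.snoc ys a : Fin (n + 1) → A) k)) =
          Fin.snoc (fun k => f (ys k)) (f a) := by
      intro A B f ys a
      exact Fin.comp_snoc f ys a
    simp only [BoundedFormula.Realize]
    constructor
    · intro hall b
      let _ : Algebra M N := h.toAlgebra
      obtain ⟨I, U, g, hg, hgd⟩ := hM.exists_ringHom_germ τ (RingHom.id N) (F := N) fun f => by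
        have := ringHom_aeval_of_semilinear (Ψ := (τ : N →+* N)) (fun m => (hh m).symm)
          (fun a : N => a) f
        change aeval (fun a : N => a) f = 0 ↔
          aeval (fun a : N => (τ : N →+* N) a) (map (σ : M →+* M) f) = 0
        rw [← this]
        exact (map_eq_zero_iff (τ : N →+* N) τ.injective).symm
      have hgh : ∀ m, g (h m) = ((fun _ => m : I → M) : Germ (U : Filter I) M) := fun m =>
        (hgd (h m) m).2 rfl
      rw [hψ hN (hM.germ U) g hg, hsnoc g]
      simp only [hgh]
      -- Łoś's theorem, applied to a representative of `g b`
      obtain ⟨y, hy⟩ := Quotient.exists_rep (g b)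
      have hy' : g b = ((y : I → M) : Germ (U : Filter I) M) := hy.symm
      rw [hy', ← hsnoc (fun a : I → M => (a : Germ (U : Filter I) M)), realize_germ_iff]
      refine Eventually.of_forall fun i => ?_
      have := hsnoc (fun a : I → M => a i) (fun k _ => xs k) y
      simp only at this
      rw [this]
      exact hall (y i)
    · intro hall a
      rw [hψ hM hN h hh, hsnoc h]
      exact hall (h a)

end Los

/-! ### Tensor products over algebraically closed fields -/

section TensorDomain

open TensorProduct

/-- The Nullstellensatz: on a finitely generated reduced algebra over an algebraically closed field,
some `K`-valued point does not vanish at a given nonzero element. -/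
theorem exists_algHom_apply_ne_zero {K B : Type*} [Field K] [IsAlgClosed K] [CommRing B]
    [IsDomain B] [Algebra K B] [Algebra.FiniteType K B] {c : B} (hc : c ≠ 0) :
    ∃ χ : B →ₐ[K] K, χ c ≠ 0 := by
  have : Nontrivial (Localization.Away c) :=
    (IsLocalization.injective (Localization.Away c)
      (powers_le_nonZeroDivisors_of_noZeroDivisors hc)).nontrivial
  have : Algebra.FiniteType B (Localization.Away c) :=
    IsLocalization.finiteType_of_monoid_fg (Submonoid.powers c) _
  have : Algebra.FiniteType K (Localization.Away c) :=
    Algebra.FiniteType.trans (S := B) inferInstance inferInstance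
  obtain ⟨m, hm⟩ := Ideal.exists_maximal (Localization.Away c)
  let _ := Ideal.Quotient.field m
  have := finite_of_finite_type_of_isJacobsonRing K (Localization.Away c ⧸ m)
  let e := AlgEquiv.ofBijective (Algebra.ofId K (Localization.Away c ⧸ m))
    IsAlgClosed.algebraMap_bijective_of_isIntegral
  let ψ : B →ₐ[K] Localization.Away c := IsScalarTower.toAlgHom K B _
  refine ⟨(e.symm : _ →ₐ[K] K).comp ((Ideal.Quotient.mkₐ K m).comp ψ), ?_⟩
  have hu : IsUnit (ψ c) := IsLocalization.Away.algebraMap_isUnit c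
  exact (hu.map ((e.symm : _ →ₐ[K] K).comp (Ideal.Quotient.mkₐ K m))).ne_zero

/-- A product of two irreducible varieties over an algebraically closed field is irreducible.
Two nonzero tensors with product zero would stay nonzero, with product zero, after specialization of
the left factor at a suitable point. -/
theorem isDomain_tensorProduct {K A B : Type*} [Field K] [IsAlgClosed K] [CommRing A] [IsDomain A]
    [CommRing B] [IsDomain B] [Algebra K A] [Algebra K B] : IsDomain (B ⊗[K] A) := by
  have : NoZeroDivisors (B ⊗[K] A) := by
    refine ⟨fun {x y} hxy => ?_⟩
    by_contra! hne
    obtain ⟨B₁, hB₁, x₁, hx₁⟩ := TensorProduct.Algebra.exists_of_fg x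
    obtain ⟨B₂, hB₂, y₂, hy₂⟩ := TensorProduct.Algebra.exists_of_fg y
    let B₀ : Subalgebra K B := B₁ ⊔ B₂
    have hfg : B₀.FG := hB₁.sup hB₂
    have : Algebra.FiniteType K B₀ := B₀.fg_iff_finiteType.1 hfg
    let ι : B₀ ⊗[K] A →ₐ[K] B ⊗[K] A := Algebra.TensorProduct.map B₀.val (AlgHom.id K A)
    have hι : Function.Injective ι :=
      Module.Flat.rTensor_preserves_injective_linearMap (M := A) B₀.val.toLinearMap
        Subtype.val_injective
    have hlift : ∀ B' : Subalgebra K B, B' ≤ B₀ → ∀ z : B' ⊗[K] A,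
        ∃ z₀, ι z₀ = LinearMap.rTensor A B'.val.toLinearMap z := fun B' h z =>
      ⟨LinearMap.rTensor A (Subalgebra.inclusion h).toLinearMap z,
        (LinearMap.rTensor_comp_apply A B₀.val.toLinearMap
          (Subalgebra.inclusion h).toLinearMap z).symm⟩
    obtain ⟨x₀, rfl⟩ := hx₁ ▸ hlift B₁ le_sup_left x₁
    obtain ⟨y₀, rfl⟩ := hy₂ ▸ hlift B₂ le_sup_right y₂
    let b := Module.Basis.ofVectorSpace K A
    let e := Algebra.TensorProduct.basis B₀ b
    rw [← map_mul, map_eq_zero_iff ι hι] at hxy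
    rw [Ne, map_eq_zero_iff ι hι, Ne, map_eq_zero_iff ι hι] at hne
    obtain ⟨i, hi⟩ : ∃ i, e.repr x₀ i ≠ 0 := by
      by_contra! h
      exact hne.1 (e.repr.map_eq_zero_iff.1 (Finsupp.ext h))
    obtain ⟨j, hj⟩ : ∃ j, e.repr y₀ j ≠ 0 := by
      by_contra! h
      exact hne.2 (e.repr.map_eq_zero_iff.1 (Finsupp.ext h))
    obtain ⟨χ, hχ⟩ := exists_algHom_apply_ne_zero (K := K) (mul_ne_zero hi hj)
    rw [map_mul] at hχ
    let ψ : B₀ ⊗[K] A →ₐ[K] A :=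
      Algebra.TensorProduct.lift ((Algebra.ofId K A).comp χ) (AlgHom.id K A)
        fun _ _ => Commute.all _ _
    have hψ : ∀ z l, b.repr (ψ z) l = χ (e.repr z l) := by
      intro z l
      induction z with
      | zero => simp
      | add z w hz hw => simp [hz, hw]
      | tmul c a => simp [ψ, e, Algebra.ofId_apply, ← Algebra.smul_def, Finsupp.mapRange_apply]
    have h0 : ψ x₀ * ψ y₀ = 0 := by rw [← map_mul, hxy, map_zero]
    rcases mul_eq_zero.1 h0 with h | h
    · apply left_ne_zero_of_mul hχ
      rw [← hψ, h, map_zero, Finsupp.zero_apply]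
    · apply right_ne_zero_of_mul hχ
      rw [← hψ, h, map_zero, Finsupp.zero_apply]
  exact NoZeroDivisors.to_isDomain _

end TensorDomain

/-! ### The algebraic closure of a difference subfield -/

section Closure

variable {M : Type u} [Field M]

theorem isAlgebraic_apply (σ : M ≃+* M) {k : Subfield M} (hk : ∀ x ∈ k, σ x ∈ k) {x : M}
    (hx : IsAlgebraic k x) : IsAlgebraic k (σ x) :=
  hx.ringHom_of_comp_eq (((σ : M →+* M).comp k.subtype).codRestrict k fun y => hk y y.2)
    (σ : M →+* M) (RingHom.injective _) rfl

theorem isAlgebraic_iterate_add (σ : M ≃+* M) {k : Subfield M} (hk : ∀ x ∈ k, σ x ∈ k) {x : M}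
    {n : ℕ} (hx : IsAlgebraic k (σ^[n] x)) (m : ℕ) : IsAlgebraic k (σ^[n + m] x) := by
  induction m with
  | zero => exact hx
  | succ m ih =>
    rw [← add_assoc, Function.iterate_succ_apply']
    exact isAlgebraic_apply σ hk ih

/-- The smallest algebraically closed subfield of `M` that contains the difference subfield `k` and
is closed under `σ` and its inverse: the elements moved into the algebraic closure of `k` by some
power of `σ`. -/
def invertiveClosure (σ : M ≃+* M) (k : Subfield M) (hk : ∀ x ∈ k, σ x ∈ k) : Subfield M where
  carrier := {x | ∃ n : ℕ, IsAlgebraic k (σ^[n] x)}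
  mul_mem' := by
    rintro x y ⟨n, hn⟩ ⟨m, hm⟩
    refine ⟨n + m, ?_⟩
    rw [iterate_map_mul]
    refine (isAlgebraic_iterate_add σ hk hn m).mul ?_
    rw [add_comm]
    exact isAlgebraic_iterate_add σ hk hm n
  add_mem' := by
    rintro x y ⟨n, hn⟩ ⟨m, hm⟩
    refine ⟨n + m, ?_⟩
    rw [iterate_map_add]
    refine (isAlgebraic_iterate_add σ hk hn m).add ?_
    rw [add_comm]
    exact isAlgebraic_iterate_add σ hk hm n
  one_mem' := ⟨0, isAlgebraic_one⟩
  zero_mem' := ⟨0, isAlgebraic_zero⟩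
  neg_mem' := by
    rintro x ⟨n, hn⟩
    exact ⟨n, by rw [iterate_map_neg]; exact hn.neg⟩
  inv_mem' := by
    rintro x ⟨n, hn⟩
    refine ⟨n, ?_⟩
    have := map_inv₀ ((σ : M →+* M) ^ n) x
    rw [RingHom.coe_pow] at this
    exact this ▸ hn.inv

variable {σ : M ≃+* M} {k : Subfield M} {hk : ∀ x ∈ k, σ x ∈ k}

theorem le_invertiveClosure : k ≤ invertiveClosure σ k hk :=
  fun x hx => ⟨0, isAlgebraic_algebraMap (⟨x, hx⟩ : k)⟩

theorem apply_mem_invertiveClosure {x : M} (hx : x ∈ invertiveClosure σ k hk) :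
    σ x ∈ invertiveClosure σ k hk := by
  obtain ⟨n, hn⟩ := hx
  refine ⟨n, ?_⟩
  rw [← Function.iterate_succ_apply, Function.iterate_succ_apply']
  exact isAlgebraic_apply σ hk hn

theorem symm_apply_mem_invertiveClosure {x : M} (hx : x ∈ invertiveClosure σ k hk) :
    σ.symm x ∈ invertiveClosure σ k hk := by
  obtain ⟨n, hn⟩ := hx
  refine ⟨n + 1, ?_⟩
  rwa [Function.iterate_succ_apply, RingEquiv.apply_symm_apply]

/-- If a power of `σ` moves the coefficients of a polynomial into the algebraic closure of `k`, it
moves its roots there as well. -/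
instance isAlgClosed_invertiveClosure [IsAlgClosed M] :
    IsAlgClosed (invertiveClosure σ k hk) := by
  refine IsAlgClosed.of_exists_root _ fun p hp hirr => ?_
  obtain ⟨x, hx⟩ := IsAlgClosed.exists_aeval_eq_zero M p hirr.degree_pos.ne'
  choose n hn using fun c : invertiveClosure σ k hk => c.2
  let N := p.support.sup fun i => n (p.coeff i)
  let s : M →+* M := (σ : M →+* M) ^ N
  have hs : ∀ y, s y = σ^[N] y := fun y => by
    rw [RingHom.coe_pow]
    rfl
  let A := algebraicClosure k M
  let q : Polynomial M := (p.map (invertiveClosure σ k hk).subtype).map s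
  have hq : q ∈ Polynomial.lifts (algebraMap A M) := by
    rw [Polynomial.lifts_iff_coeff_lifts]
    intro i
    by_cases hi : i ∈ p.support
    · refine ⟨⟨q.coeff i, ?_⟩, rfl⟩
      obtain ⟨m, hm⟩ := Nat.exists_eq_add_of_le (Finset.le_sup (f := fun i => n (p.coeff i)) hi)
      have := isAlgebraic_iterate_add σ hk (hn (p.coeff i)) m
      rw [← hm] at this
      simp only [q, Polynomial.coeff_map, hs]
      exact mem_algebraicClosure_iff.2 this
    · refine ⟨0, ?_⟩
      simp [q, Polynomial.notMem_support_iff.1 hi]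
  obtain ⟨r, hr⟩ := hq
  have hx0 : Polynomial.aeval (s x) r = 0 := by
    change Polynomial.eval₂ (algebraMap A M) (s x) r = 0
    rw [← Polynomial.eval_map, show r.map (algebraMap A M) = q from hr, Polynomial.eval_map_apply]
    exact (congrArg s ((Polynomial.eval_map _ _).trans hx)).trans (map_zero s)
  have hr0 : r ≠ 0 := by
    rintro rfl
    have : q.Monic := (hp.map _).map _
    exact this.ne_zero (by rw [← hr]; simp)
  have halg : IsAlgebraic A (s x) := ⟨r, hr0, hx0⟩
  have : x ∈ invertiveClosure σ k hk := ⟨N, by rw [← hs]; exact halg.restrictScalars k⟩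
  refine ⟨⟨x, this⟩, Subtype.val_injective ?_⟩
  exact (Polynomial.aeval_algebraMap_apply M (⟨x, this⟩ : invertiveClosure σ k hk) p).symm.trans hx

end Closure

/-! ### Definable closure -/

section DefinableClosure

open TensorProduct FirstOrder Language

theorem exists_ringHom_tensorProduct {K A B C : Type*} [CommRing K] [CommRing A] [CommRing B]
    [CommRing C] [Algebra K A] [Algebra K B] (f : A →+* C) (g : B →+* C)
    (h : ∀ c, f (algebraMap K A c) = g (algebraMap K B c)) :
    ∃ Ψ : A ⊗[K] B →+* C, ∀ a b, Ψ (a ⊗ₜ b) = f a * g b := by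
  let _ : Algebra K C := (f.comp (algebraMap K A)).toAlgebra
  let f' : A →ₐ[K] C := { f with commutes' := fun _ => rfl }
  let g' : B →ₐ[K] C := { g with commutes' := fun c => (h c).symm }
  let Ψ : A ⊗[K] B →ₐ[K] C := Algebra.TensorProduct.lift f' g' fun _ _ => Commute.all _ _
  exact ⟨Ψ, fun a b => Algebra.TensorProduct.lift_tmul f' g' (fun _ _ => Commute.all _ _) a b⟩

/-- An automorphism that preserves a subfield `K`, as does its inverse, acts on both factors of the
tensor square over `K`. -/
theorem exists_injective_ringHom_tensorProduct {M : Type*} [Field M] (K : Subfield M) (σ : M ≃+* M)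
    (h : ∀ x ∈ K, σ x ∈ K) (h' : ∀ x ∈ K, σ.symm x ∈ K) :
    ∃ Ψ : M ⊗[K] M →+* M ⊗[K] M, Function.Injective Ψ ∧
      ∀ a b, Ψ (a ⊗ₜ b) = σ a ⊗ₜ σ b := by
  have key : ∀ ρ : M ≃+* M, (∀ x ∈ K, ρ x ∈ K) →
      ∃ Ψ : M ⊗[K] M →+* M ⊗[K] M, ∀ a b, Ψ (a ⊗ₜ b) = ρ a ⊗ₜ ρ b := by
    intro ρ hρ
    obtain ⟨Ψ, hΨ⟩ := exists_ringHom_tensorProduct (K := K)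
      ((Algebra.TensorProduct.includeLeftRingHom : M →+* M ⊗[K] M).comp (ρ : M →+* M))
      ((Algebra.TensorProduct.includeRight : M →ₐ[K] M ⊗[K] M).toRingHom.comp (ρ : M →+* M))
      fun c => by
        change ρ c ⊗ₜ[K] (1 : M) = (1 : M) ⊗ₜ[K] ρ c
        exact Algebra.TensorProduct.tmul_one_eq_one_tmul (A := M) (B := M) (⟨ρ c, hρ c c.2⟩ : K)
    refine ⟨Ψ, fun a b => (hΨ a b).trans ?_⟩
    simp
  obtain ⟨Ψ, hΨ⟩ := key σ h
  obtain ⟨Φ, hΦ⟩ := key σ.symm h'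
  refine ⟨Ψ, Function.LeftInverse.injective (g := Φ) fun z => ?_, hΨ⟩
  induction z with
  | zero => simp
  | add x y hx hy => rw [map_add, map_add, hx, hy]
  | tmul a b => simp [hΨ, hΦ]

/-- The definable closure of a difference subfield consists of elements that some power of `σ` moves
into its algebraic closure. Two copies of `M` are amalgamated freely over the invertive closure `K`
of `k`; the free amalgam embeds in an ultrapower of `M` over the first copy. An element outside `K`
has two distinct copies there, but by model completeness they satisfy the same formulas over
`k`. -/
theorem dclSigma_subset_invertiveClosure {M : Type u} [Field M] [IsAlgClosed M] {σ : M ≃+* M}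
    (hM : IsExistentiallyClosed σ) {k : Subfield M} (hk : ∀ x ∈ k, σ x ∈ k) :
    dclSigma σ (k : Set M) ⊆ invertiveClosure σ k hk := by
  intro b hb
  let K := invertiveClosure σ k hk
  have : IsDomain (M ⊗[K] M) := isDomain_tensorProduct
  let F := FractionRing (M ⊗[K] M)
  let r : M →+* M ⊗[K] M := (Algebra.TensorProduct.includeRight : M →ₐ[K] M ⊗[K] M)
  let j : M →+* F := (algebraMap (M ⊗[K] M) F).comp r
  have hinj : Function.Injective (algebraMap (M ⊗[K] M) F) := IsFractionRing.injective _ _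
  obtain ⟨Ψ, hΨ, hΨt⟩ := exists_injective_ringHom_tensorProduct K σ
    (fun _ => apply_mem_invertiveClosure) (fun _ => symm_apply_mem_invertiveClosure)
  -- the second copy of `M` has a `σ`-invariant type over the first, because of `σ ⊗ σ`
  have hj : ∀ f : MvPolynomial M M,
      aeval (fun a => j a) f = 0 ↔ aeval (fun a => j (σ a)) (map (σ : M →+* M) f) = 0 := by
    intro f
    have h1 : ∀ (δ : M → M ⊗[K] M) (p : MvPolynomial M M),
        aeval (fun a => algebraMap _ F (δ a)) p = algebraMap _ F (aeval δ p) :=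
      fun δ p => aeval_algebraMap_apply F δ p
    have h2 := ringHom_aeval_of_semilinear (K := M ⊗[K] M) (Ω := M ⊗[K] M) (σ := σ) (Ψ := Ψ)
      (fun m => (hΨt m 1).trans (by rw [map_one]; rfl)) r f
    have h3 : (fun a => Ψ (r a)) = fun a => r (σ a) := funext fun a =>
      (hΨt 1 a).trans (by rw [map_one]; rfl)
    rw [h3] at h2
    change aeval (fun a => algebraMap _ F (r a)) f = 0 ↔
      aeval (fun a => algebraMap _ F (r (σ a))) (map (σ : M →+* M) f) = 0
    rw [h1, h1, map_eq_zero_iff _ hinj, map_eq_zero_iff _ hinj, ← h2, map_eq_zero_iff _ hΨ]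
  obtain ⟨I, U, g, hg, hgd⟩ := hM.exists_ringHom_germ σ j hj
  -- the image of `a` is the diagonal copy of `m` only if the copies agree in the tensor product
  have hjK : ∀ a m, g a = diagonal U M m ↔ m ⊗ₜ[K] (1 : M) = 1 ⊗ₜ[K] a := fun a m =>
    (hgd a m).trans (hinj.eq_iff.trans eq_comm)
  have hfix : ∀ c : k, g c = diagonal U M c := fun c =>
    (hjK c c).2 (Algebra.TensorProduct.tmul_one_eq_one_tmul (A := M) (B := M)
      (⟨c, le_invertiveClosure c.2⟩ : K))
  let _ : diffRing.Structure M := diffRingStructure σ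
  obtain ⟨φ, hφ⟩ := Set.definable_iff_exists_formula_sum.1 hb
  have hφ' : ∀ y : M, φ.Realize (Sum.elim (↑) fun _ : Fin 1 => y) ↔ y = b := fun y =>
    (Set.ext_iff.1 hφ fun _ => y).symm
  obtain ⟨y, hy⟩ := Quotient.exists_rep (g b)
  have hy' : g b = ((y : I → M) : Germ (U : Filter I) M) := hy.symm
  have hb' := (realize_iff_of_ringHom φ hM (hM.germ U) g hg _ default).1 ((hφ' b).2 rfl)
  let v : ((k : Set M) ⊕ Fin 1) → I → M := Sum.elim (fun c _ => c) fun _ => y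
  have hv : (fun a => g (Sum.elim (↑) (fun _ : Fin 1 => b) a)) =
      fun a => ((v a : I → M) : Germ (U : Filter I) M) := by
    funext a
    rcases a with c | a
    · exact hfix c
    · exact hy'
  rw [hv, Subsingleton.elim (fun a => g _) fun a : Fin 0 => (((default : Fin 0 → I → M) a : I → M) :
    Germ (U : Filter I) M), realize_germ_iff] at hb'
  -- almost all coordinates of a representative of `g b` solve `φ`, hence are equal to `b`
  have hbg : g b = diagonal U M b := by
    rw [hy']
    refine Germ.coe_eq.2 (hb'.mono fun i hi => (hφ' (y i)).1 ?_)
    have hvi : (fun a => v a i) = Sum.elim (↑) fun _ : Fin 1 => y i := by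
      funext a
      rcases a with c | a <;> rfl
    rw [hvi] at hi
    rw [Formula.Realize]
    convert hi
  -- the two copies of `M` in the tensor square over `K` meet in `K`, by faithful flatness
  have heff := Algebra.IsEffective.of_faithfullyFlat K M
  obtain ⟨c, hc⟩ := (heff b).1 (by
    rw [Algebra.TensorProduct.includeLeftSubRight_apply, (hjK b b).1 hbg, sub_self])
  rw [← hc]
  exact c.2

end DefinableClosure

/-! ### Linear disjointness from the fixed field -/

section LinearDisjoint

variable {M : Type*} [Field M] {σ : M ≃+* M} {k : Subfield M}

/-- A shortest relation over `k`, with one coefficient normalized to `1`, minus its image under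
`σ`, is a shorter one: so its coefficients are fixed by `σ`. -/
theorem linearIndependent_of_fixedField (hk : ∀ x ∈ k, σ x ∈ k) {ι : Type*} {b : ι → M}
    (hb : ∀ i, σ (b i) = b i) (h : LinearIndependent (fixedFieldOf σ k) b) :
    LinearIndependent k b := by
  classical
  have key : ∀ (s : Finset ι) (c : ι → M), (∀ i, c i ∈ k) → ∑ i ∈ s, c i * b i = 0 →
      ∀ i ∈ s, c i = 0 := by
    intro s
    induction s using Finset.induction_on with
    | empty => simp
    | insert a s ha ih =>
      intro c hc hsum
      have hca : c a = 0 := by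
        by_contra hne
        have hd : ∑ i ∈ insert a s, c i / c a * b i = 0 := by
          simp_rw [div_mul_eq_mul_div]
          rw [← Finset.sum_div, hsum, zero_div]
        have hd' : ∑ i ∈ insert a s, σ (c i / c a) * b i = 0 := by
          simpa [hb] using congrArg σ hd
        have hsub : ∑ i ∈ s, (σ (c i / c a) - c i / c a) * b i = 0 := by
          have := sub_eq_zero.2 (hd'.trans hd.symm)
          rw [← Finset.sum_sub_distrib, Finset.sum_insert ha, div_self hne] at this
          simpa [sub_mul] using this
        have hmem : ∀ i, c i / c a ∈ k := fun i => k.div_mem (hc i) (hc a)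
        have hs := ih _ (fun i => k.sub_mem (hk _ (hmem i)) (hmem i)) hsub
        have hfix : ∀ i ∈ insert a s, c i / c a ∈ fixedFieldOf σ k := by
          intro i hi
          refine ⟨hmem i, ?_⟩
          rcases Finset.mem_insert.1 hi with rfl | hi
          · rw [div_self hne]
            exact (fixedField σ).one_mem
          · exact sub_eq_zero.1 (hs i hi)
        let d : ι → fixedFieldOf σ k := fun i =>
          if hi : i ∈ insert a s then ⟨c i / c a, hfix i hi⟩ else 0
        have hd0 : ∑ i ∈ insert a s, d i • b i = 0 := by
          rw [← hd]
          refine Finset.sum_congr rfl fun i hi => ?_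
          simp only [d, dif_pos hi]
          rfl
        have := linearIndependent_iff'.1 h _ d hd0 a (Finset.mem_insert_self a s)
        rw [show d a = _ from dif_pos (Finset.mem_insert_self a s)] at this
        exact one_ne_zero ((div_self hne).symm.trans (congrArg Subtype.val this))
      rw [Finset.sum_insert ha, hca, zero_mul, zero_add] at hsum
      intro i hi
      rcases Finset.mem_insert.1 hi with rfl | hi
      · exact hca
      · exact ih c hc hsum i hi
  rw [linearIndependent_iff']
  intro s g hg i hi
  exact Subtype.val_injective (key s (fun i => g i) (fun i => (g i).2) hg i hi)

theorem linearDisjoint_fixedField (hk : ∀ x ∈ k, σ x ∈ k) :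
    (Subfield.extendScalars (fixedFieldOf_le_left σ k)).LinearDisjoint
      (Subfield.extendScalars (fixedFieldOf_le_right σ k)) := by
  let B := Subfield.extendScalars (fixedFieldOf_le_right σ k)
  let b := Module.Basis.ofVectorSpace (fixedFieldOf σ k) B
  refine IntermediateField.LinearDisjoint.of_basis_right b ?_
  exact linearIndependent_of_fixedField hk (b := B.val ∘ b) (fun i => (b i).2)
    (b.linearIndependent.map' B.val.toLinearMap (LinearMap.ker_eq_bot.2 Subtype.val_injective))

/-- The powers of `b` lie in the fixed field, so a relation between them over `k` gives one over
the fixed field of `k`. -/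
theorem isAlgebraic_fixedFieldOf (hk : ∀ x ∈ k, σ x ∈ k) {b : M} (hb : σ b = b)
    (h : IsAlgebraic k b) : IsAlgebraic (fixedFieldOf σ k) b := by
  by_contra htr
  have hF : LinearIndependent (fixedFieldOf σ k) fun n : ℕ => b ^ n := by
    have := (Polynomial.basisMonomials (fixedFieldOf σ k)).linearIndependent.map'
      (Polynomial.aeval b).toLinearMap
      (LinearMap.ker_eq_bot.2 (transcendental_iff_injective.1 htr))
    have heq : (Polynomial.aeval b).toLinearMap ∘
        Polynomial.basisMonomials (fixedFieldOf σ k) = fun n : ℕ => b ^ n := by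
      funext n
      simp
    exact heq ▸ this
  have hind := linearIndependent_of_fixedField hk (fun n => by rw [map_pow, hb]) hF
  obtain ⟨p, hp, hpb⟩ := h
  rw [Polynomial.aeval_eq_sum_range] at hpb
  refine hp (Polynomial.leadingCoeff_eq_zero.1 ?_)
  exact linearIndependent_iff'.1 hind _ p.coeff hpb p.natDegree (Finset.self_mem_range_succ _)

end LinearDisjoint

section AlgebraicClosure

open FirstOrder Language

/-- The zeros of a polynomial over `K` form a finite set definable over `K`. -/
theorem mem_aclField_of_isAlgebraic {M : Type*} [Field M] {K : Subfield M} {b : M}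
    (h : IsAlgebraic K b) : b ∈ aclField (K : Set M) := by
  obtain ⟨p, hp, hb⟩ := h
  let _ : Ring.CompatibleRing M := Ring.compatibleRingOfRing M
  let f₀ : MvPolynomial (Fin 1) K := p.toMvPolynomial 0
  let f : MvPolynomial (Fin 1) M := map K.subtype f₀
  have hf : ∀ x : Fin 1 → M, aeval x f = Polynomial.aeval (x 0) p := fun x => by
    rw [← aeval_toMvPolynomial]
    exact aeval_map_algebraMap M x f₀
  refine ⟨{x | Polynomial.aeval x p = 0}, ?_, ?_, hb⟩
  · refine (p.rootSet_finite M).subset fun x hx => ?_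
    exact Polynomial.mem_rootSet.2 ⟨hp, hx⟩
  · have hdef := Ring.mvPolynomial_zeroLocus_definable ({f} : Finset (MvPolynomial (Fin 1) M))
    have hset : zeroLocus M (Ideal.span
        (({f} : Finset (MvPolynomial (Fin 1) M)) : Set (MvPolynomial (Fin 1) M))) =
        {x : Fin 1 → M | Polynomial.aeval (x 0) p = 0} := by
      rw [zeroLocus_span]
      ext x
      simp only [Finset.coe_singleton, Set.mem_singleton_iff, forall_eq, Set.mem_ofPred_eq, hf]
    rw [hset] at hdef
    refine hdef.mono ?_
    simp only [Finset.mem_singleton, Set.iUnion_iUnion_eq_left]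
    rintro _ ⟨i, -, rfl⟩
    change coeff i f ∈ K
    rw [coeff_map]
    exact (coeff i f₀).2

end AlgebraicClosure

end ACFA

theorem mainTheorem9 {M : Type*} [Field M] (σ : M ≃+* M) (hM : ACFA.IsModel M σ)
    (k : Subfield M) (hk : ∀ x ∈ k, σ x ∈ k) :
    (Subfield.extendScalars (ACFA.fixedFieldOf_le_left σ k)).LinearDisjoint
        (Subfield.extendScalars (ACFA.fixedFieldOf_le_right σ k)) ∧
      ACFA.dclSigma σ (k : Set M) ∩ (ACFA.fixedField σ : Set M) ⊆
        ACFA.aclField (ACFA.fixedFieldOf σ k : Set M) ∩ (ACFA.fixedField σ : Set M) := by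
  refine ⟨ACFA.linearDisjoint_fixedField hk, fun b hb => ⟨?_, hb.2⟩⟩
  have : IsAlgClosed M := hM.isAlgClosed
  have hσb : σ b = b := hb.2
  obtain ⟨n, hn⟩ := ACFA.dclSigma_subset_invertiveClosure hM.isExistentiallyClosed hk hb.1
  rw [Function.iterate_fixed hσb] at hn
  exact ACFA.mem_aclField_of_isAlgebraic (ACFA.isAlgebraic_fixedFieldOf hk hσb hn)
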